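/- In the Connected Odd Cycle Transversal problem the input is a finite simple undirected graph $G=(V,E)$ and an integer $k\ge 0$, and the question is whether there is a set $S\subseteq V$ with $|S|\le k$ such that $G-S$ is bipartite and the induced subgraph $G[S]$ is connected (in particular, nonempty). A linear arrangement of a graph $G$ with $n$ vertices is a bijection $\ell\colon\{1,\dots,n\}\to V$. Its cutwidth is $\mathrm{ctw}(\ell)=\max_{1\le i\le n}\bigl|\{\{\ell(a),\ell(b)\}\in E : a\le i<b\}\bigr|$ (and $0$ if $n=0$), and $\mathrm{ctw}(G)$ is the minimum of $\mathrm{ctw}(\ell)$ over all linear arrangements $\ell$ of $G$. Algorithms are deterministic random access machine programs (unit-cost addition and subtraction, no multiplication), and a running time is $O^*(f)$ if it is at most $f$ times a polynomial in the input size. The Strong Exponential Time Hypothesis (SETH) states that for every real $\delta>0$ there is an integer $d$ such that $d$-SAT (satisfiability of CNF formulas with at most $d$ literals in every clause) cannot be solved in time $O^*((2-\delta)^n)$, where $n$ is the number of variables. Theorem. Assume SETH, and let $\varepsilon>0$ be real. Then no algorithm solves Connected Odd Cycle Transversal on all inputs $(G,k)$ in time $O^*\bigl((4-\varepsilon)^{\mathrm{ctw}(G)}\bigr)$.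 This remains true if a linear arrangement is given: no algorithm solves Connected Odd Cycle Transversal on all inputs $(G,k,\ell)$, where $\ell$ is a linear arrangement of $G$, in time $O^*\bigl((4-\varepsilon)^{\mathrm{ctw}(\ell)}\bigr)$. -/

import Mathlib

/-!
Deterministic random access machines with a step count, decision problems and the
running times `O*(f)` over them, `d`-SAT and the Strong Exponential Time Hypothesis, linear
arrangements and cutwidth, and the problem Connected Odd Cycle Transversal.
-/

namespace RAM

/-- Integer expressions of a program: constants, registers, addition, truncated subtraction, and
reading cell `i` of array `a`. There is deliberately no multiplication: one step can increase the
bit length of a number only by a constant, so that unit-cost running times are polynomially related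
to the running times of Turing machines. -/
inductive Expr : Type
  | const (c : ℕ)
  | var (x : ℕ)
  | add (e₁ e₂ : Expr)
  | sub (e₁ e₂ : Expr)
  | get (a : ℕ) (i : Expr)

/-- Programs. A program mentions finitely many registers and finitely many arrays; every array has
unboundedly many cells with computable (indirect) addresses. Tests ask whether an expression is
nonzero. -/
inductive Program : Type
  | skip
  | assign (x : ℕ) (e : Expr)
  | store (a : ℕ) (i e : Expr)
  | seq (p q : Program)
  | ite (e : Expr) (p q : Program)
  | loop (e : Expr) (p : Program)

/-- The memory: the contents of the registers and of the arrays. -/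
structure State : Type where
  var : ℕ → ℕ
  arr : ℕ → ℕ → ℕ

/-- The value of an expression. -/
def Expr.value (s : State) : Expr → ℕ
  | .const c => c
  | .var x => s.var x
  | .add e₁ e₂ => e₁.value s + e₂.value s
  | .sub e₁ e₂ => e₁.value s - e₂.value s
  | .get a i => s.arr a (i.value s)

/-- Set register `x` to `v`. -/
def State.setVar (s : State) (x v : ℕ) : State :=
  { s with var := Function.update s.var x v }

/-- Set cell `i` of array `a` to `v`. -/
def State.setArr (s : State) (a i v : ℕ) : State :=
  { s with arr := Function.update s.arr a (Function.update (s.arr a) i v) }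

/-- `Runs p s s' t`: started in memory `s`, the program `p` halts after exactly `t` steps, in
memory `s'`. Every assignment, every store and every test of a branch or of a loop (`while e ≠ 0`)
is one step. -/
inductive Runs : Program → State → State → ℕ → Prop
  | skip (s : State) : Runs .skip s s 1
  | assign (x : ℕ) (e : Expr) (s : State) :
      Runs (.assign x e) s (s.setVar x (e.value s)) 1
  | store (a : ℕ) (i e : Expr) (s : State) :
      Runs (.store a i e) s (s.setArr a (i.value s) (e.value s)) 1
  | seq {p q : Program} {s s' s'' : State} {t t' : ℕ} :
      Runs p s s' t → Runs q s' s'' t' → Runs (.seq p q) s s'' (t + t')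
  | iteTrue {e : Expr} {p q : Program} {s s' : State} {t : ℕ} :
      e.value s ≠ 0 → Runs p s s' t → Runs (.ite e p q) s s' (t + 1)
  | iteFalse {e : Expr} {p q : Program} {s s' : State} {t : ℕ} :
      e.value s = 0 → Runs q s s' t → Runs (.ite e p q) s s' (t + 1)
  | loopDone {e : Expr} {p : Program} {s : State} :
      e.value s = 0 → Runs (.loop e p) s s 1
  | loopStep {e : Expr} {p : Program} {s s' s'' : State} {t t' : ℕ} :
      e.value s ≠ 0 → Runs p s s' t → Runs (.loop e p) s' s'' t' →
      Runs (.loop e p) s s'' (t + t' + 1)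

/-- The initial memory on input `w`: array `0` holds `w`, everything else is zero. -/
def initial (w : List ℕ) : State where
  var := fun _ => 0
  arr := fun a i => if a = 0 then w.getD i 0 else 0

end RAM

/-- A decision problem: instances, their encoding as a word of natural numbers, and the
yes-instances. -/
structure DecisionProblem where
  Instance : Type
  encode : Instance → List ℕ
  IsYes : Instance → Prop

namespace DecisionProblem

/-- The size of an instance: the total bit length of its encoding, with one separator for every
number. -/
def size (P : DecisionProblem) (I : P.Instance) : ℕ :=
  ((P.encode I).map fun a => Nat.size a + 1).sum

/-- The program `p` halts on every instance `I` of `P` after at most `T I` steps, and it accepts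
(register `0` is nonzero when it halts) exactly the yes-instances. -/
def SolvedBy (P : DecisionProblem) (p : RAM.Program) (T : P.Instance → ℝ) : Prop :=
  ∀ I : P.Instance, ∃ (s : RAM.State) (t : ℕ),
    RAM.Runs p (RAM.initial (P.encode I)) s t ∧ (t : ℝ) ≤ T I ∧ (s.var 0 ≠ 0 ↔ P.IsYes I)

/-- `P` can be solved in time `O*(f)`, that is, in time `f` times a polynomial in the size of the
instance. -/
def SolvableInOStar (P : DecisionProblem) (f : P.Instance → ℝ) : Prop :=
  ∃ (p : RAM.Program) (C c : ℕ), P.SolvedBy p fun I => C * f I * (P.size I : ℝ) ^ c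

end DecisionProblem

/-- A formula in conjunctive normal form over the variables `0, …, numVars - 1`. The literal
`(x, b)` says that `x` has the truth value `b`. -/
structure CNFFormula where
  numVars : ℕ
  clauses : List (List (Fin numVars × Bool))

namespace CNFFormula

/-- Some assignment satisfies a literal of every clause. -/
def Satisfiable (φ : CNFFormula) : Prop :=
  ∃ v : Fin φ.numVars → Bool, ∀ c ∈ φ.clauses, ∃ l ∈ c, v l.1 = l.2

/-- The number of variables, the number of clauses, and then every clause as its length followed by
its literals; the literal `(x, b)` is the number `2 x + b`. -/
def encode (φ : CNFFormula) : List ℕ :=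
  φ.numVars :: φ.clauses.length ::
    φ.clauses.flatMap fun c => c.length :: c.map fun l => 2 * (l.1 : ℕ) + l.2.toNat

end CNFFormula

/-- `d`-SAT: satisfiability of formulas in conjunctive normal form all of whose clauses have at most
`d` literals. -/
def dSAT (d : ℕ) : DecisionProblem where
  Instance := {φ : CNFFormula // ∀ c ∈ φ.clauses, c.length ≤ d}
  encode φ := φ.1.encode
  IsYes φ := φ.1.Satisfiable

/-- The Strong Exponential Time Hypothesis: for every `δ > 0` there is a `d` such that `d`-SAT with
`n` variables cannot be solved in time `O*((2 - δ) ^ n)`. -/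
def SETH : Prop :=
  ∀ δ : ℝ, 0 < δ → ∃ d : ℕ, ¬ (dSAT d).SolvableInOStar fun φ => (2 - δ) ^ φ.1.numVars

namespace SimpleGraph

/-- The cut of the linear arrangement `ℓ` at position `i`: the edges with one end at a position
`≤ i` and the other end at a position `> i`. -/
def arrangementCut {n : ℕ} {V : Type*} (G : SimpleGraph V) (ℓ : Fin n ≃ V) (i : Fin n) :
    Set (Sym2 V) :=
  {e | e ∈ G.edgeSet ∧ ∃ j k : Fin n, j ≤ i ∧ i < k ∧ e = s(ℓ j, ℓ k)}

/-- The cutwidth of the linear arrangement `ℓ`: the largest size of a cut. -/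
noncomputable def arrangementWidth {n : ℕ} {V : Type*} (G : SimpleGraph V) (ℓ : Fin n ≃ V) : ℕ :=
  Finset.univ.sup fun i : Fin n => (G.arrangementCut ℓ i).ncard

/-- The cutwidth of a graph: the smallest cutwidth of a linear arrangement. -/
noncomputable def cutwidth {n : ℕ} (G : SimpleGraph (Fin n)) : ℕ :=
  ⨅ ℓ : Fin n ≃ Fin n, G.arrangementWidth ℓ

/-- `S` is a connected odd cycle transversal: `G - S` is bipartite and `G[S]` is connected. -/
def IsConnectedOCT {V : Type*} (G : SimpleGraph V) (S : Set V) : Prop :=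
  (G.induce Sᶜ).IsBipartite ∧ (G.induce S).Connected

end SimpleGraph

/-- A graph on the vertices `0, …, n - 1`, and a number `k`. -/
structure GraphWithBudget where
  n : ℕ
  G : SimpleGraph (Fin n)
  k : ℕ

namespace GraphWithBudget

/-- `G` has a connected odd cycle transversal of cardinality at most `k`. -/
def HasConnectedOCT (I : GraphWithBudget) : Prop :=
  ∃ S : Finset (Fin I.n), S.card ≤ I.k ∧ I.G.IsConnectedOCT (S : Set (Fin I.n))

open Classical in
/-- `n`, `k`, and the rows of the adjacency matrix. -/
noncomputable def encode (I : GraphWithBudget) : List ℕ :=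
  I.n :: I.k ::
    (List.finRange I.n).flatMap fun i =>
      (List.finRange I.n).map fun j => if I.G.Adj i j then 1 else 0

end GraphWithBudget

/-- A graph, a number `k`, and a linear arrangement of the graph. -/
structure ArrangedGraphWithBudget extends GraphWithBudget where
  arrangement : Fin n ≃ Fin n

/-- Connected Odd Cycle Transversal. -/
noncomputable def ConnectedOCT : DecisionProblem where
  Instance := GraphWithBudget
  encode := GraphWithBudget.encode
  IsYes := GraphWithBudget.HasConnectedOCT

/-- Connected Odd Cycle Transversal when a linear arrangement of the graph is given as part of the
input; it is appended as the list of the vertices in the order of the arrangement. -/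
noncomputable def ConnectedOCTArranged : DecisionProblem where
  Instance := ArrangedGraphWithBudget
  encode I := I.toGraphWithBudget.encode ++
    (List.finRange I.n).map fun i => (I.arrangement i : ℕ)
  IsYes I := I.toGraphWithBudget.HasConnectedOCT

/-! A formula with `n` variables is turned into a graph of cutwidth at most `n / 2 + O(1)`. Each of
the roughly `n / 2` horizontal paths stores two variables by choosing one of four types, so time `(4
- ε) ^ ctw` would decide `d`-SAT in time about `√(4 - ε) ^ n`, with a base below `2` that does not
depend on `d`.

The graph is a grid of segments with 90 vertices each, arranged in columns of `N` segments, `N` odd.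
An OR gadget on `a, b` is a five-cycle through both whose other three vertices have no further
neighbours: a connected transversal that avoids `a` and `b` would have to take one of the three and
would be cut off from the rest. The gadgets and the forced root vertices cost at least 8 vertices
per segment. The budget is exactly 8 per segment, so a solution leaves out exactly one type vertex
in each segment, and this choice determines how the two path ends behave (`segment`,
`left_mem_iff`).

The four types are the four states of a path end. In types `0` and `1` both ends are in `S`, and
only the right end, respectively only the left end, is attached to the root inside the segment. In
types `2` and `3` the ends are outside `S`, with one or the other colour relative to a reference
colour. Connectivity and bipartiteness across the edge to the next column allow a type to change
only along `0 → {2, 3} → 1` or `0 → 1` (`follows`). A path thus changes at most twice. With `2 N +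
2` rounds of columns, each round containing every clause, some round has no change on any path
(`exists_constant_round`), and its types define an assignment.

Clauses are checked by columns. The vertices `10` of a column form an odd cycle, so one of them is
in `S`; this is compatible with the budget only if the type of that segment satisfies the clause
(`exists_types`). Conversely, a satisfying assignment gives the same types in every column
(`isSolution_solution`). Only the `N` path edges and boundedly many others cross a cut of the
natural order (`arrangementWidth_le`).

The remainder implements the reduction on the machine: every cell of the output is a term with
bounded sums, such terms compile to polynomial-time programs (`runs_compile`, `exists_pow_bound`),
and the assumed algorithm is then run on the output (`exists_program_comp`, `dSAT_solvable`). -/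

/-! ### Terms with bounded sums, their compilation and their cost. -/

namespace RAM

/-- A stack of values with `i` pushed on top of `σ`. -/
def push (i : ℕ) (σ : ℕ → ℕ) : ℕ → ℕ
  | 0 => i
  | k + 1 => σ k

@[simp] theorem push_zero (i : ℕ) (σ : ℕ → ℕ) : push i σ 0 = i := rfl

@[simp] theorem push_succ (i : ℕ) (σ : ℕ → ℕ) (k : ℕ) : push i σ (k + 1) = σ k := rfl

/-- Terms with bounded sums over two read-only arrays, in de Bruijn notation: `sum b e` is the sum
of `e` over all values smaller than `b` of the variable `0`. -/
inductive Term : Type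
  | const (c : ℕ)
  | var (k : ℕ)
  | add (e₁ e₂ : Term)
  | sub (e₁ e₂ : Term)
  | input (e : Term)
  | table (e : Term)
  | sum (b e : Term)

namespace Term

/-- The value of a term over the arrays `A` and `B` in the environment `σ`. -/
def eval (A B : ℕ → ℕ) : Term → (ℕ → ℕ) → ℕ
  | const c, _ => c
  | var k, σ => σ k
  | add e₁ e₂, σ => e₁.eval A B σ + e₂.eval A B σ
  | sub e₁ e₂, σ => e₁.eval A B σ - e₂.eval A B σ
  | input e, σ => A (e.eval A B σ)
  | table e, σ => B (e.eval A B σ)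
  | sum b e, σ => ∑ i ∈ Finset.range (b.eval A B σ), e.eval A B (push i σ)

/-- The number of steps of the compiled term. -/
def cost (A B : ℕ → ℕ) : Term → (ℕ → ℕ) → ℕ
  | const _, _ => 1
  | var _, _ => 1
  | add e₁ e₂, σ => e₁.cost A B σ + e₂.cost A B σ + 1
  | sub e₁ e₂, σ => e₁.cost A B σ + e₂.cost A B σ + 1
  | input e, σ => e.cost A B σ + 1
  | table e, σ => e.cost A B σ + 1
  | sum b e, σ =>
    b.cost A B σ + ∑ i ∈ Finset.range (b.eval A B σ), (e.cost A B (push i σ) + 3) + 4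

/-- A program that writes the value of a term to register `2 d`; the variable `k` of the term is
in register `2 (ρ k)`, and the registers that are odd or smaller than `2 d` are preserved. -/
def compile : Term → (ℕ → ℕ) → ℕ → Program
  | const c, _, d => .assign (2 * d) (.const c)
  | var k, ρ, d => .assign (2 * d) (.var (2 * ρ k))
  | add e₁ e₂, ρ, d =>
    .seq (e₁.compile ρ d) (.seq (e₂.compile ρ (d + 1))
      (.assign (2 * d) (.add (.var (2 * d)) (.var (2 * (d + 1))))))
  | sub e₁ e₂, ρ, d =>
    .seq (e₁.compile ρ d) (.seq (e₂.compile ρ (d + 1))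
      (.assign (2 * d) (.sub (.var (2 * d)) (.var (2 * (d + 1))))))
  | input e, ρ, d => .seq (e.compile ρ d) (.assign (2 * d) (.get 0 (.var (2 * d))))
  | table e, ρ, d => .seq (e.compile ρ d) (.assign (2 * d) (.get 1 (.var (2 * d))))
  | sum b e, ρ, d =>
    .seq (b.compile ρ d) (.seq (.assign (2 * (d + 1)) (.const 0))
      (.seq (.assign (2 * (d + 2)) (.const 0))
        (.seq (.loop (.sub (.var (2 * d)) (.var (2 * (d + 2))))
          (.seq (e.compile (push (d + 2) ρ) (d + 3))
            (.seq (.assign (2 * (d + 1)) (.add (.var (2 * (d + 1))) (.var (2 * (d + 3)))))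
              (.assign (2 * (d + 2)) (.add (.var (2 * (d + 2))) (.const 1))))))
          (.assign (2 * d) (.var (2 * (d + 1)))))))

end Term

/-- The memory `s'` agrees with `s` on the arrays and on all registers that are odd or smaller than
`2 d`. -/
def AgreeBelow (d : ℕ) (s s' : State) : Prop :=
  s'.arr = s.arr ∧ ∀ r, r % 2 = 1 ∨ r < 2 * d → s'.var r = s.var r

theorem AgreeBelow.trans {d d' : ℕ} {s s' s'' : State} (h : AgreeBelow d s s')
    (h' : AgreeBelow d' s' s'') (hd : d ≤ d') : AgreeBelow d s s'' :=
  ⟨h'.1.trans h.1, fun r hr => (h'.2 r (by omega)).trans (h.2 r hr)⟩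

theorem AgreeBelow.setVar {d : ℕ} {s s' : State} (h : AgreeBelow d s s') {j : ℕ} (hj : d ≤ j)
    (v : ℕ) : AgreeBelow d s (s'.setVar (2 * j) v) :=
  ⟨h.1, fun r hr => by
    rw [← h.2 r hr]
    exact Function.update_of_ne (by omega) _ _⟩

theorem AgreeBelow.refl (d : ℕ) (s : State) : AgreeBelow d s s := ⟨rfl, fun _ _ => rfl⟩

@[simp] theorem State.setVar_var_self (s : State) (x v : ℕ) : (s.setVar x v).var x = v :=
  Function.update_self _ _ _

theorem State.setVar_var_of_ne (s : State) {x y : ℕ} (v : ℕ) (h : y ≠ x) :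
    (s.setVar x v).var y = s.var y :=
  Function.update_of_ne h _ _

@[simp] theorem State.setVar_arr (s : State) (x v : ℕ) : (s.setVar x v).arr = s.arr := rfl

/-- A loop that is executed exactly `n` times. -/
theorem Runs.loop_count {e : Expr} {p : Program} {n : ℕ} (I : ℕ → State → Prop) (c : ℕ → ℕ)
    (hstep : ∀ i < n, ∀ s, I i s → e.value s ≠ 0 ∧ ∃ s', Runs p s s' (c i) ∧ I (i + 1) s')
    (hdone : ∀ s, I n s → e.value s = 0) {s : State} (hs : I 0 s) :
    ∃ s', Runs (.loop e p) s s' (∑ i ∈ Finset.range n, (c i + 1) + 1) ∧ I n s' := by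
  have key : ∀ k, k ≤ n → ∀ s, I (n - k) s →
      ∃ s', Runs (.loop e p) s s' (∑ i ∈ Finset.Ico (n - k) n, (c i + 1) + 1) ∧ I n s' := by
    intro k
    induction k with
    | zero =>
      intro _ s hs
      exact ⟨s, by simpa using Runs.loopDone (hdone s (by simpa using hs)), by simpa using hs⟩
    | succ k ih =>
      intro hk s hs
      obtain ⟨h0, s', hr, hs'⟩ := hstep (n - (k + 1)) (by omega) s hs
      rw [show n - (k + 1) + 1 = n - k by omega] at hs'
      obtain ⟨s'', hr', hs''⟩ := ih (by omega) s' hs'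
      refine ⟨s'', ?_, hs''⟩
      have := Runs.loopStep h0 hr hr'
      rw [Finset.sum_eq_sum_Ico_succ_bot (by omega : n - (k + 1) < n),
        show n - (k + 1) + 1 = n - k by omega]
      convert this using 1
      ring
  have := key n le_rfl s (by simpa using hs)
  rwa [Nat.sub_self, ← Finset.range_eq_Ico] at this

namespace Term

/-- Even registers from `2 d` on are scratch space, so a subterm compiled at a larger `d` cannot
disturb earlier results. Odd registers are reserved for a program to be simulated later. -/
theorem runs_compile (e : Term) : ∀ (ρ : ℕ → ℕ) (d : ℕ) (s : State), (∀ k, ρ k < d) →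
    ∃ s', Runs (e.compile ρ d) s s' (e.cost (s.arr 0) (s.arr 1) fun k => s.var (2 * ρ k)) ∧
      AgreeBelow d s s' ∧
      s'.var (2 * d) = e.eval (s.arr 0) (s.arr 1) fun k => s.var (2 * ρ k) := by
  have two (e₁ e₂ : Term) (ρ : ℕ → ℕ) (d : ℕ) (s : State) (hρ : ∀ k, ρ k < d)
      (ih₁ : ∃ s', Runs (e₁.compile ρ d) s s' (e₁.cost (s.arr 0) (s.arr 1) fun k => s.var (2 * ρ k)) ∧
        AgreeBelow d s s' ∧ s'.var (2 * d) = e₁.eval (s.arr 0) (s.arr 1) fun k => s.var (2 * ρ k))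
      (ih₂ : ∀ s, ∃ s', Runs (e₂.compile ρ (d + 1)) s s'
          (e₂.cost (s.arr 0) (s.arr 1) fun k => s.var (2 * ρ k)) ∧ AgreeBelow (d + 1) s s' ∧
        s'.var (2 * (d + 1)) = e₂.eval (s.arr 0) (s.arr 1) fun k => s.var (2 * ρ k)) :
      ∃ s₁ s₂, Runs (e₁.compile ρ d) s s₁ (e₁.cost (s.arr 0) (s.arr 1) fun k => s.var (2 * ρ k)) ∧
        Runs (e₂.compile ρ (d + 1)) s₁ s₂ (e₂.cost (s.arr 0) (s.arr 1) fun k => s.var (2 * ρ k)) ∧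
        AgreeBelow d s s₂ ∧
        s₂.var (2 * d) = (e₁.eval (s.arr 0) (s.arr 1) fun k => s.var (2 * ρ k)) ∧
        s₂.var (2 * (d + 1)) = e₂.eval (s.arr 0) (s.arr 1) fun k => s.var (2 * ρ k) := by
    obtain ⟨s₁, h₁, a₁, v₁⟩ := ih₁
    obtain ⟨s₂, h₂, a₂, v₂⟩ := ih₂ s₁
    have hσ : (fun k => s₁.var (2 * ρ k)) = fun k => s.var (2 * ρ k) :=
      funext fun k => a₁.2 _ (Or.inr (by have := hρ k; omega))
    rw [a₁.1, hσ] at h₂ v₂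
    exact ⟨s₁, s₂, h₁, h₂, a₁.trans a₂ (by omega),
      (a₂.2 _ (Or.inr (by omega))).trans v₁, v₂⟩
  induction e with
  | const c => exact fun ρ d s _ => ⟨_, .assign _ _ _, (AgreeBelow.refl d s).setVar le_rfl _, by
      simp [eval, Expr.value]⟩
  | var k => exact fun ρ d s _ => ⟨_, .assign _ _ _, (AgreeBelow.refl d s).setVar le_rfl _, by
      simp [eval, Expr.value]⟩
  | add e₁ e₂ ih₁ ih₂ =>
    intro ρ d s hρ
    obtain ⟨s₁, s₂, h₁, h₂, a, v₁, v₂⟩ := two e₁ e₂ ρ d s hρ (ih₁ ρ d s hρ)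
      fun s => ih₂ ρ (d + 1) s fun k => (hρ k).trans (Nat.lt_succ_self d)
    refine ⟨_, ?_, a.setVar le_rfl ((Expr.add (.var (2 * d)) (.var (2 * (d + 1)))).value s₂), by
      simp [Expr.value, eval, v₁, v₂]⟩
    simpa [cost, compile, add_assoc] using h₁.seq (h₂.seq (.assign _ _ _))
  | sub e₁ e₂ ih₁ ih₂ =>
    intro ρ d s hρ
    obtain ⟨s₁, s₂, h₁, h₂, a, v₁, v₂⟩ := two e₁ e₂ ρ d s hρ (ih₁ ρ d s hρ)
      fun s => ih₂ ρ (d + 1) s fun k => (hρ k).trans (Nat.lt_succ_self d)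
    refine ⟨_, ?_, a.setVar le_rfl ((Expr.sub (.var (2 * d)) (.var (2 * (d + 1)))).value s₂), by
      simp [Expr.value, eval, v₁, v₂]⟩
    simpa [cost, compile, add_assoc] using h₁.seq (h₂.seq (.assign _ _ _))
  | input e ih =>
    intro ρ d s hρ
    obtain ⟨s₁, h₁, a₁, v₁⟩ := ih ρ d s hρ
    exact ⟨_, h₁.seq (.assign _ _ _), a₁.setVar le_rfl _, by simp [Expr.value, eval, v₁, a₁.1]⟩
  | table e ih =>
    intro ρ d s hρ
    obtain ⟨s₁, h₁, a₁, v₁⟩ := ih ρ d s hρ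
    exact ⟨_, h₁.seq (.assign _ _ _), a₁.setVar le_rfl _, by simp [Expr.value, eval, v₁, a₁.1]⟩
  | sum b e ihb ihe =>
    intro ρ d s hρ
    obtain ⟨s₁, h₁, a₁, v₁⟩ := ihb ρ d s hρ
    set σ : ℕ → ℕ := fun k => s.var (2 * ρ k) with hσ
    set n := b.eval (s.arr 0) (s.arr 1) σ with hn
    -- Loop invariant: slot `d` holds the bound, `d + 1` the partial sum, `d + 2` the summation
    -- index; the summand is computed from `d + 3` on.
    let I : ℕ → State → Prop := fun i s' => AgreeBelow d s s' ∧ s'.var (2 * d) = n ∧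
      s'.var (2 * (d + 2)) = i ∧
      s'.var (2 * (d + 1)) = ∑ j ∈ Finset.range i, e.eval (s.arr 0) (s.arr 1) (push j σ)
    have loop := Runs.loop_count (e := .sub (.var (2 * d)) (.var (2 * (d + 2))))
      (p := .seq (e.compile (push (d + 2) ρ) (d + 3))
            (.seq (.assign (2 * (d + 1)) (.add (.var (2 * (d + 1))) (.var (2 * (d + 3)))))
              (.assign (2 * (d + 2)) (.add (.var (2 * (d + 2))) (.const 1))))) (n := n) I
      (fun i => e.cost (s.arr 0) (s.arr 1) (push i σ) + (1 + 1)) ?_ ?_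
      (s := (s₁.setVar (2 * (d + 1)) 0).setVar (2 * (d + 2)) 0) ?_
    · obtain ⟨s₂, h₂, a₂, v₂, -, w₂⟩ := loop
      refine ⟨_, ?_, a₂.setVar le_rfl ((Expr.var (2 * (d + 1))).value s₂), by
        simpa [Expr.value, eval] using w₂⟩
      have := h₁.seq (.seq (.assign (2 * (d + 1)) (.const 0) s₁)
        (.seq (.assign (2 * (d + 2)) (.const 0) _)
          (.seq h₂ (.assign (2 * d) (.var (2 * (d + 1))) s₂))))
      convert this using 1
      · rfl
      · simp only [cost, ← hn, add_assoc, Nat.reduceAdd]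
        omega
    · rintro i hi s' ⟨a, v, w, u⟩
      refine ⟨by simp only [Expr.value, v, w]; omega, ?_⟩
      obtain ⟨s₂, h₂, a₂, v₂⟩ := ihe (push (d + 2) ρ) (d + 3) s' (by
        rintro (_ | k)
        · simp
        · have := hρ k
          simp only [push_succ]
          omega)
      have hσ' : (fun k => s'.var (2 * push (d + 2) ρ k)) = push i σ := by
        funext k
        cases k with
        | zero => simpa using w
        | succ k => exact a.2 _ (Or.inr (by have := hρ k; simp only [push_succ]; omega))
      rw [a.1, hσ'] at h₂ v₂
      refine ⟨_, h₂.seq ((Runs.assign _ _ _).seq (.assign _ _ _)),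
        ((a.trans a₂ (by omega)).setVar (by omega) _).setVar (by omega) _, ?_, ?_, ?_⟩
      · rw [State.setVar_var_of_ne _ _ (by omega), State.setVar_var_of_ne _ _ (by omega),
          a₂.2 _ (Or.inr (by omega)), v]
      · rw [State.setVar_var_self]
        simp only [Expr.value]
        rw [State.setVar_var_of_ne _ _ (by omega), a₂.2 _ (Or.inr (by omega)), w]
      · rw [State.setVar_var_of_ne _ _ (by omega), State.setVar_var_self]
        simp only [Expr.value]
        rw [a₂.2 _ (Or.inr (by omega)), u, v₂, Finset.sum_range_succ]
    · rintro s' ⟨-, v, w, -⟩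
      simp [Expr.value, v, w]
    · refine ⟨(a₁.setVar (by omega) _).setVar (by omega) _, ?_, by simp, ?_⟩
      · rw [State.setVar_var_of_ne _ _ (by omega), State.setVar_var_of_ne _ _ (by omega), v₁]
      · rw [State.setVar_var_of_ne _ _ (by omega)]
        simp

/-- Values and running times of terms are bounded by a power of the numbers in the memory. -/
theorem exists_pow_bound (e : Term) : ∃ c : ℕ, ∀ X ≥ 2, ∀ (A B σ : ℕ → ℕ), (∀ i, A i ≤ X) →
    (∀ i, B i ≤ X) → (∀ k, σ k ≤ X) → e.eval A B σ ≤ X ^ c ∧ e.cost A B σ ≤ X ^ c := by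
  have two (X a b c₁ c₂ : ℕ) (hX : 2 ≤ X) (ha : a ≤ X ^ c₁) (hb : b ≤ X ^ c₂) :
      a + b + 1 ≤ X ^ (c₁ + c₂ + 2) := by
    have h₁ : 1 ≤ X ^ c₁ := Nat.one_le_pow _ _ (by omega)
    have h₂ : 1 ≤ X ^ c₂ := Nat.one_le_pow _ _ (by omega)
    have h₃ : 4 ≤ X ^ 2 := by nlinarith
    calc a + b + 1 ≤ X ^ c₁ * X ^ c₂ * 4 := by nlinarith
      _ ≤ X ^ c₁ * X ^ c₂ * X ^ 2 := by gcongr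
      _ = _ := by ring
  induction e with
  | const c =>
    refine ⟨c + 1, fun X hX A B σ _ _ _ => ⟨?_, Nat.one_le_pow _ _ (by omega)⟩⟩
    calc c ≤ c + 1 := by omega
      _ ≤ 2 ^ (c + 1) := Nat.lt_two_pow_self.le
      _ ≤ X ^ (c + 1) := Nat.pow_le_pow_left hX _
  | var k => exact ⟨1, fun X hX A B σ _ _ h => ⟨by simpa [eval] using h k, by simp [cost]; omega⟩⟩
  | add e₁ e₂ ih₁ ih₂ =>
    obtain ⟨c₁, h₁⟩ := ih₁
    obtain ⟨c₂, h₂⟩ := ih₂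
    refine ⟨c₁ + c₂ + 2, fun X hX A B σ hA hB hσ => ?_⟩
    have k₁ := h₁ X hX A B σ hA hB hσ
    have k₂ := h₂ X hX A B σ hA hB hσ
    exact ⟨(Nat.le_succ _).trans (two X _ _ c₁ c₂ hX k₁.1 k₂.1), two X _ _ c₁ c₂ hX k₁.2 k₂.2⟩
  | sub e₁ e₂ ih₁ ih₂ =>
    obtain ⟨c₁, h₁⟩ := ih₁
    obtain ⟨c₂, h₂⟩ := ih₂
    refine ⟨c₁ + c₂ + 2, fun X hX A B σ hA hB hσ => ?_⟩
    have k₁ := h₁ X hX A B σ hA hB hσ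
    have k₂ := h₂ X hX A B σ hA hB hσ
    have := two X _ _ c₁ c₂ hX k₁.1 k₂.1
    exact ⟨by simp only [eval]; omega, two X _ _ c₁ c₂ hX k₁.2 k₂.2⟩
  | input e ih =>
    obtain ⟨c, h⟩ := ih
    refine ⟨c + 0 + 2, fun X hX A B σ hA hB hσ => ?_⟩
    have k := h X hX A B σ hA hB hσ
    have := two X _ 0 c 0 hX k.2 (by simp)
    exact ⟨(hA _).trans (Nat.le_self_pow (by omega) X), by simpa [cost] using this⟩
  | table e ih =>
    obtain ⟨c, h⟩ := ih
    refine ⟨c + 0 + 2, fun X hX A B σ hA hB hσ => ?_⟩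
    have k := h X hX A B σ hA hB hσ
    have := two X _ 0 c 0 hX k.2 (by simp)
    exact ⟨(hB _).trans (Nat.le_self_pow (by omega) X), by simpa [cost] using this⟩
  | sum b e ihb ihe =>
    obtain ⟨c₁, h₁⟩ := ihb
    obtain ⟨c₂, h₂⟩ := ihe
    -- The summation index can be as large as `X ^ c₁`, so the bound for the summand is used with `X
    -- ^ (c₁ + 1) ≥ X` in place of `X`. The factor `X ^ 4 ≥ 16` absorbs the additive constants.
    refine ⟨4 + c₁ + (c₁ + 1) * c₂, fun X hX A B σ hA hB hσ => ?_⟩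
    have k₁ := h₁ X hX A B σ hA hB hσ
    have hXY : X ≤ X ^ (c₁ + 1) := Nat.le_self_pow (by omega) X
    have k₂ : ∀ i ∈ Finset.range (b.eval A B σ), e.eval A B (push i σ) ≤ (X ^ (c₁ + 1)) ^ c₂ ∧
        e.cost A B (push i σ) ≤ (X ^ (c₁ + 1)) ^ c₂ := by
      intro i hi
      refine h₂ _ (hX.trans hXY) A B _ (fun i => (hA i).trans hXY) (fun i => (hB i).trans hXY) ?_
      rintro (_ | k)
      · exact ((Finset.mem_range.1 hi).le.trans k₁.1).trans (Nat.pow_le_pow_right (by omega) (by omega))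
      · exact (hσ k).trans hXY
    have e₁ := Finset.sum_le_card_nsmul _ _ _ fun i hi => (k₂ i hi).1
    have e₂ := Finset.sum_le_card_nsmul _ _ _ fun i hi => Nat.add_le_add_right (k₂ i hi).2 3
    simp only [Finset.card_range, smul_eq_mul] at e₁ e₂
    have p₁ : 1 ≤ X ^ c₁ := Nat.one_le_pow _ _ (by omega)
    have p₂ : 1 ≤ (X ^ (c₁ + 1)) ^ c₂ := Nat.one_le_pow _ _ (by positivity)
    have p₃ : 2 ^ 4 ≤ X ^ 4 := Nat.pow_le_pow_left hX 4
    have hexp : X ^ (4 + c₁ + (c₁ + 1) * c₂) = X ^ 4 * (X ^ c₁ * (X ^ (c₁ + 1)) ^ c₂) := by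
      rw [← pow_mul, pow_add, pow_add, mul_assoc]
    rw [hexp]
    generalize (X ^ (c₁ + 1)) ^ c₂ = b' at *
    generalize X ^ c₁ = a' at *
    have hab : a' ≤ a' * b' := Nat.le_mul_of_pos_right _ p₂
    have q : 16 * (a' * b') ≤ X ^ 4 * (a' * b') := Nat.mul_le_mul_right _ (by simpa using p₃)
    have m₁ : b.eval A B σ * b' ≤ a' * b' := Nat.mul_le_mul_right _ k₁.1
    have m₂ : b.eval A B σ * (b' + 3) ≤ a' * (b' + 3) := Nat.mul_le_mul_right _ k₁.1
    have m₃ : a' * (b' + 3) = a' * b' + 3 * a' := by ring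
    have hk := k₁.2
    constructor
    · simp only [eval]
      omega
    · simp only [cost]
      omega

end Term

end RAM

/-! ### Running a program on a computed input. -/

namespace RAM

/-- Rename the registers and the arrays of an expression. -/
def Expr.rename (f g : ℕ → ℕ) : Expr → Expr
  | .const c => .const c
  | .var x => .var (f x)
  | .add e₁ e₂ => .add (e₁.rename f g) (e₂.rename f g)
  | .sub e₁ e₂ => .sub (e₁.rename f g) (e₂.rename f g)
  | .get a i => .get (g a) (i.rename f g)

/-- Rename the registers and the arrays of a program. -/
def Program.rename (f g : ℕ → ℕ) : Program → Program
  | .skip => .skip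
  | .assign x e => .assign (f x) (e.rename f g)
  | .store a i e => .store (g a) (i.rename f g) (e.rename f g)
  | .seq p q => .seq (p.rename f g) (q.rename f g)
  | .ite e p q => .ite (e.rename f g) (p.rename f g) (q.rename f g)
  | .loop e p => .loop (e.rename f g) (p.rename f g)

/-- The memory `s` is stored in the registers `f x` and the arrays `g a` of `s'`. -/
def Embeds (f g : ℕ → ℕ) (s s' : State) : Prop :=
  (∀ x, s'.var (f x) = s.var x) ∧ ∀ a, s'.arr (g a) = s.arr a

theorem Expr.value_rename {f g : ℕ → ℕ} {s s' : State} (h : Embeds f g s s') (e : Expr) :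
    (e.rename f g).value s' = e.value s := by
  induction e <;> simp_all [Expr.rename, Expr.value, h.1, h.2]

/-- Injectivity keeps distinct cells distinct, so the renamed run simulates the original step by
step. Nothing is required of memory outside the images of `f` and `g`, which may hold other data. -/
theorem Runs.rename {f g : ℕ → ℕ} (hf : f.Injective) (hg : g.Injective) {p : Program}
    {s₁ s₂ : State} {t : ℕ} (h : Runs p s₁ s₂ t) :
    ∀ {s₁' : State}, Embeds f g s₁ s₁' →
      ∃ s₂', Runs (p.rename f g) s₁' s₂' t ∧ Embeds f g s₂ s₂' := by
  induction h with
  | skip s => exact fun h => ⟨_, .skip _, h⟩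
  | assign x e s =>
    refine fun h => ⟨_, .assign _ _ _, fun y => ?_, h.2⟩
    simp only [State.setVar, Expr.value_rename h]
    simp [Function.update_apply, h.1, hf.eq_iff]
  | store a i e s =>
    refine fun h => ⟨_, .store _ _ _ _, h.1, fun b => ?_⟩
    simp only [State.setArr, Expr.value_rename h]
    by_cases hb : b = a
    · subst hb
      simp [h.2]
    · rw [Function.update_of_ne (hg.ne hb), Function.update_of_ne hb, h.2]
  | seq _ _ ih₁ ih₂ =>
    intro s₁' h
    obtain ⟨s₂', r₁, h₂⟩ := ih₁ h
    obtain ⟨s₃', r₂, h₃⟩ := ih₂ h₂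
    exact ⟨_, r₁.seq r₂, h₃⟩
  | iteTrue he _ ih =>
    intro s₁' h
    obtain ⟨s₂', r, h₂⟩ := ih h
    exact ⟨_, .iteTrue (by rwa [Expr.value_rename h]) r, h₂⟩
  | iteFalse he _ ih =>
    intro s₁' h
    obtain ⟨s₂', r, h₂⟩ := ih h
    exact ⟨_, .iteFalse (by rwa [Expr.value_rename h]) r, h₂⟩
  | loopDone he => exact fun h => ⟨_, .loopDone (by rwa [Expr.value_rename h]), h⟩
  | loopStep he _ _ ih₁ ih₂ =>
    intro s₁' h
    obtain ⟨s₂', r₁, h₂⟩ := ih₁ h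
    obtain ⟨s₃', r₂, h₃⟩ := ih₂ h₂
    exact ⟨_, .loopStep (by rwa [Expr.value_rename h]) r₁ r₂, h₃⟩

/-- The position of block `j` in an array in which every block follows its length, the first length
being in cell `2`. -/
def blockStart (A : ℕ → ℕ) : ℕ → ℕ
  | 0 => 2
  | j + 1 => blockStart A j + 1 + A (blockStart A j)

/-- The table of the positions of the first `k` blocks. -/
def blockTable (A : ℕ → ℕ) (k : ℕ) : ℕ → ℕ := fun j => if j ≤ k then blockStart A j else 0

theorem update_blockTable (A : ℕ → ℕ) (k : ℕ) :
    Function.update (blockTable A k) (k + 1) (blockStart A (k + 1)) = blockTable A (k + 1) := by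
  funext j
  by_cases hj : j = k + 1
  · subst hj
    simp [blockTable]
  · rw [Function.update_of_ne hj]
    simp only [blockTable]
    congr 1
    simp only [eq_iff_iff]
    omega

/-- The memory after a list has been written to array `2` up to position `i`. -/
def prefixArr (out : ℕ → ℕ) (i : ℕ) : ℕ → ℕ := fun j => if j < i then out j else 0

theorem update_prefixArr (out : ℕ → ℕ) (i : ℕ) :
    Function.update (prefixArr out i) i (out i) = prefixArr out (i + 1) := by
  funext j
  by_cases hj : j = i
  · subst hj
    simp [prefixArr]
  · rw [Function.update_of_ne hj]
    simp only [prefixArr]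
    congr 1
    simp only [eq_iff_iff]
    omega

/-- Tabulate the positions of the blocks of array `0` in array `1`. -/
def tabulate : Program :=
  .seq (.store 1 (.const 0) (.const 2))
    (.loop (.sub (.get 0 (.const 1)) (.var 0))
      (.seq (.store 1 (.add (.var 0) (.const 1))
        (.add (.add (.get 1 (.var 0)) (.const 1)) (.get 0 (.get 1 (.var 0)))))
        (.assign 0 (.add (.var 0) (.const 1)))))

/-- Clauses have varying lengths, so their positions come from a recursion that terms do not
provide. Once tabulated, a position is a single read. -/
theorem runs_tabulate (w : List ℕ) : ∃ s, Runs tabulate (initial w) s (3 * w.getD 1 0 + 2) ∧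
    (∀ r ≠ 0, s.var r = 0) ∧ s.arr 0 = (fun i => w.getD i 0) ∧
    s.arr 1 = blockTable (fun i => w.getD i 0) (w.getD 1 0) ∧ ∀ a ≥ 2, s.arr a = fun _ => 0 := by
  set A : ℕ → ℕ := fun i => w.getD i 0 with hA
  obtain ⟨s, hr, h⟩ := Runs.loop_count (e := .sub (.get 0 (.const 1)) (.var 0))
    (p := .seq (.store 1 (.add (.var 0) (.const 1))
        (.add (.add (.get 1 (.var 0)) (.const 1)) (.get 0 (.get 1 (.var 0)))))
        (.assign 0 (.add (.var 0) (.const 1)))) (n := A 1)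
    (fun i s => s.var 0 = i ∧ (∀ r ≠ 0, s.var r = 0) ∧ s.arr 0 = A ∧
      s.arr 1 = blockTable A i ∧ ∀ a ≥ 2, s.arr a = fun _ => 0) (fun _ => 1 + 1)
    (by
      rintro i hi s ⟨h0, hv, h₀, h₁, h₂⟩
      refine ⟨by simp only [Expr.value, h₀, h0]; omega, _,
        (Runs.store _ _ _ _).seq (.assign _ _ _), ?_, ?_, ?_, ?_, ?_⟩
      · simp [State.setVar, State.setArr, Expr.value, h0]
      · intro r hr
        simp [State.setVar, State.setArr, Function.update_of_ne hr, hv r hr]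
      · simp [State.setVar, State.setArr, h₀]
      · simp only [State.setVar, State.setArr, Expr.value, h₀, h₁, h0, Function.update_self]
        rw [← update_blockTable]
        simp [blockTable, blockStart]
      · intro a ha
        simp only [State.setVar, State.setArr]
        rw [Function.update_of_ne (by omega), h₂ a ha])
    (by
      rintro s ⟨h0, -, h₀, -⟩
      simp [Expr.value, h0, h₀])
    (s := (initial w).setArr 1 0 2) (by
      refine ⟨rfl, fun _ _ => rfl, ?_, ?_, ?_⟩
      · simp [State.setArr, initial, hA]
      · funext j
        cases j <;> simp [State.setArr, initial, blockTable, blockStart]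
      · intro a ha
        simp only [State.setArr, initial]
        rw [Function.update_of_ne (by omega)]
        simp [show a ≠ 0 by omega])
  refine ⟨s, ?_, h.2⟩
  have := (Runs.store 1 (.const 0) (.const 2) (initial w)).seq hr
  convert this using 1
  · rfl
  · simp only [Finset.sum_const, Finset.card_range, smul_eq_mul, hA]
    ring

/-- Write the values of `e` below the value of `len` to array `2`. -/
def emit (len e : Term) : Program :=
  .seq (.assign 0 (.const 0)) (.seq (len.compile (fun _ => 0) 1)
    (.loop (.sub (.var 2) (.var 0)) (.seq (e.compile (fun _ => 0) 2)
      (.seq (.store 2 (.var 0) (.var 4)) (.assign 0 (.add (.var 0) (.const 1)))))))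

/-- Array `2` must start out zero so that afterwards it is zero beyond the written word, as in
`initial`. -/
theorem runs_emit (len e : Term) (s : State) (h2 : s.arr 2 = fun _ => 0) :
    ∃ s', Runs (emit len e) s s' (len.cost (s.arr 0) (s.arr 1) (fun _ => 0) +
      ∑ i ∈ Finset.range (len.eval (s.arr 0) (s.arr 1) fun _ => 0),
        (e.cost (s.arr 0) (s.arr 1) (fun _ => i) + 3) + 2) ∧
      (∀ r, r % 2 = 1 → s'.var r = s.var r) ∧ (∀ a ≠ 2, s'.arr a = s.arr a) ∧
      s'.arr 2 = prefixArr (fun i => e.eval (s.arr 0) (s.arr 1) fun _ => i)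
        (len.eval (s.arr 0) (s.arr 1) fun _ => 0) := by
  set A := s.arr 0 with hA
  set B := s.arr 1 with hB
  obtain ⟨s₁, r₁, a₁, v₁⟩ := len.runs_compile (fun _ => 0) 1 (s.setVar 0 0) (by simp)
  simp only [mul_zero, State.setVar_var_self, State.setVar_arr, ← hA, ← hB] at r₁ v₁
  set n := len.eval A B (fun _ => 0) with hn
  obtain ⟨s₂, r₂, h⟩ := Runs.loop_count (e := .sub (.var 2) (.var 0))
    (p := .seq (e.compile (fun _ => 0) 2)
      (.seq (.store 2 (.var 0) (.var 4)) (.assign 0 (.add (.var 0) (.const 1))))) (n := n)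
    (fun i s' => s'.var 0 = i ∧ s'.var 2 = n ∧ (∀ r, r % 2 = 1 → s'.var r = s.var r) ∧
      (∀ a ≠ 2, s'.arr a = s.arr a) ∧ s'.arr 2 = prefixArr (fun i => e.eval A B fun _ => i) i)
    (fun i => e.cost A B (fun _ => i) + (1 + 1))
    (by
      rintro i hi s' ⟨h0, hn', hv, ha, hp⟩
      obtain ⟨s'', r, a, v⟩ := e.runs_compile (fun _ => 0) 2 s' (by simp)
      simp only [mul_zero, h0, ha 0 (by simp), ha 1 (by simp), ← hA, ← hB] at r v
      refine ⟨by simp only [Expr.value, h0, hn']; omega, _,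
        r.seq ((Runs.store _ _ _ _).seq (.assign _ _ _)), ?_, ?_, ?_, ?_, ?_⟩
      · simp [State.setVar, State.setArr, Expr.value, a.2 0 (by simp), h0]
      · simp [State.setVar, State.setArr, Expr.value, a.2 2 (by simp), hn']
      · intro r hr
        simp only [State.setVar, State.setArr]
        rw [Function.update_of_ne (by omega), a.2 r (Or.inl hr), hv r hr]
      · intro b hb
        simp only [State.setVar, State.setArr]
        rw [Function.update_of_ne hb, a.1, ha b hb]
      · simp only [State.setVar, State.setArr, Expr.value, Function.update_self]
        rw [a.1, hp, a.2 0 (by simp), h0, show (4 : ℕ) = 2 * 2 from rfl, v]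
        exact update_prefixArr (fun i => e.eval A B fun _ => i) i)
    (by
      rintro s' ⟨h0, hn', -⟩
      simp [Expr.value, h0, hn'])
    (s := s₁) (by
      refine ⟨by simpa using a₁.2 0 (by simp), by simpa using v₁, ?_, ?_, ?_⟩
      · intro r hr
        rw [a₁.2 r (Or.inl hr), State.setVar_var_of_ne _ _ (by omega)]
      · intro a _
        rw [a₁.1, State.setVar_arr]
      · rw [a₁.1, State.setVar_arr, h2]
        funext j
        simp [prefixArr])
  refine ⟨s₂, ?_, h.2.2⟩
  have := (Runs.assign 0 (.const 0) s).seq (r₁.seq r₂)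
  convert this using 1
  · rfl
  · simp only [add_assoc, Nat.reduceAdd]
    omega

/-- The number of steps of `tabulate` and `emit` on input `w`, and of copying the answer. -/
def overhead (len e : Term) (w : List ℕ) : ℕ :=
  3 * w.getD 1 0 + len.cost (fun i => w.getD i 0)
      (blockTable (fun i => w.getD i 0) (w.getD 1 0)) (fun _ => 0) +
    ∑ i ∈ Finset.range (len.eval (fun i => w.getD i 0)
      (blockTable (fun i => w.getD i 0) (w.getD 1 0)) fun _ => 0),
      (e.cost (fun i => w.getD i 0) (blockTable (fun i => w.getD i 0) (w.getD 1 0)) (fun _ => i) +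
        3) + 5

/-- A program for a problem can be run on the output of a pair of terms. -/
theorem exists_program_comp (len e : Term) (p : Program) : ∃ q : Program, ∀ w out : List ℕ,
    (out.length = len.eval (fun i => w.getD i 0)
      (blockTable (fun i => w.getD i 0) (w.getD 1 0)) fun _ => 0) →
    (∀ i < out.length, out.getD i 0 = e.eval (fun i => w.getD i 0)
      (blockTable (fun i => w.getD i 0) (w.getD 1 0)) fun _ => i) →
    ∀ s t, Runs p (initial out) s t →
      ∃ s', Runs q (initial w) s' (overhead len e w + t) ∧ s'.var 0 = s.var 0 := by
  -- The simulated program lives on odd registers and on the arrays from `2` on. The first two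
  -- stages leave these zero, except that array `2` becomes its input. Its answer, in register `1`,
  -- is copied to register `0`.
  refine ⟨.seq tabulate (.seq (emit len e)
    (.seq (p.rename (fun x => 2 * x + 1) (fun a => a + 2)) (.assign 0 (.var 1)))), ?_⟩
  intro w out hlen hout s t hr
  obtain ⟨s₁, r₁, v₁, e₀, e₁, e₂⟩ := runs_tabulate w
  obtain ⟨s₂, r₂, v₂, f₀, f₂⟩ := runs_emit len e s₁ (e₂ 2 le_rfl)
  rw [e₀, e₁] at r₂ f₂
  obtain ⟨s₃, r₃, h₃⟩ := hr.rename (f := fun x => 2 * x + 1) (g := fun a => a + 2)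
    (fun x y h => by simpa using h) (fun x y h => by simpa using h) (s₁' := s₂) (by
      refine ⟨fun x => ?_, fun a => ?_⟩
      · dsimp only
        rw [v₂ _ (by omega), v₁ _ (by omega)]
        rfl
      · rcases a with _ | a
        · rw [f₂, ← hlen]
          funext i
          simp only [prefixArr, initial, if_true]
          split_ifs with hi
          · exact (hout i hi).symm
          · exact (List.getD_eq_default _ _ (by omega)).symm
        · dsimp only
          rw [f₀ _ (by omega), e₂ _ (by omega)]
          simp [initial])
  refine ⟨s₃.setVar 0 (s₃.var 1), ?_, (State.setVar_var_self _ _ _).trans (h₃.1 0)⟩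
  have := r₁.seq (r₂.seq (r₃.seq (.assign 0 (.var 1) s₃)))
  convert this using 1
  · rfl
  · simp only [overhead]
    omega

end RAM

/-! ### The grid of segments, and a solution inside one segment. -/

namespace CycleTransversal

/-- The pairs `(a, b)` of vertices of a segment of which at least one must be taken, with the number
of the gadget that is responsible for it. -/
def orGadgets : List (ℕ × ℕ × ℕ) :=
  [(0, 1, 0), (0, 2, 1), (0, 3, 2), (1, 2, 3), (1, 3, 4), (2, 3, 5),
    (4, 6, 6), (5, 7, 7), (8, 9, 8), (10, 11, 9),
    (0, 4, 10), (0, 5, 11), (1, 4, 12), (1, 5, 13), (2, 6, 14), (2, 7, 15), (3, 6, 16), (3, 7, 17),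
    (0, 9, 18), (1, 8, 19)]

/-- The gadgets for the pairs that depend on the formula. -/
def optionalGadgets : List (ℕ × ℕ × ℕ) := [(11, 0, 20), (11, 1, 21), (11, 2, 22), (11, 3, 23)]

/-- The edges inside a segment. Vertices `0, …, 3` select one of four types, `4` and `5` are the left
and the right end, `12` is the root, `16` the reference colour, and the vertices from `18` on belong
to the five-cycles of the gadgets. -/
def innerEdges : List (ℕ × ℕ) :=
  [(12, 0), (12, 1), (12, 2), (12, 3), (12, 6), (12, 7), (12, 8), (12, 9), (12, 10), (12, 11),
    (12, 13), (12, 14), (13, 14), (4, 8), (5, 9), (15, 4), (15, 5), (15, 2), (15, 3), (16, 17),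
    (2, 16), (3, 17)] ++
  (orGadgets.map fun g => (g.2.1, 18 + 3 * g.2.2)) ++
  (orGadgets ++ optionalGadgets).flatMap fun g =>
    [(g.1, 18 + 3 * g.2.2), (g.2.1, 19 + 3 * g.2.2), (19 + 3 * g.2.2, 20 + 3 * g.2.2),
      (g.1, 20 + 3 * g.2.2)]

/-- The directed edges from vertex `a` of segment `s` to vertex `b` of segment `s'`, for `M`
segments in columns of `N`; `good j i t` says that type `t` on path `i` is good for column `j`. -/
def Link (N M : ℕ) (good : ℕ → ℕ → ℕ → Prop) (s a s' b : ℕ) : Prop :=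
  (s' = s ∧ (a, b) ∈ innerEdges) ∨
  (s' = s ∧ a < 4 ∧ ¬ good (s / N) (s % N) a ∧ b = 78 + 3 * a) ∨
  (s' = s ∧ s < N ∧ a = 4 ∧ b = 12) ∨
  (s' = s ∧ M ≤ s + N ∧ a = 5 ∧ b = 12) ∨
  (s' = s + 1 ∧ (a = 12 ∨ a = 16) ∧ b = a) ∨
  (s' = s + 1 ∧ s' % N ≠ 0 ∧ a = 10 ∧ b = 10) ∨
  (s' + 1 = s + N ∧ s % N = 0 ∧ a = 10 ∧ b = 10) ∨
  (s' = s + N ∧ a = 5 ∧ b = 4)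

/-- The graph with the edges `Link`. -/
def grid (N M : ℕ) (good : ℕ → ℕ → ℕ → Prop) : SimpleGraph (ℕ × ℕ) :=
  SimpleGraph.fromRel fun u v => Link N M good u.1 u.2 v.1 v.2

/-- `S` is a connected odd cycle transversal of the first `M` segments of the grid, with eight
vertices for every segment, and `c` is a colouring of the rest. -/
structure IsSolution (N M : ℕ) (good : ℕ → ℕ → ℕ → Prop) (S : Finset (ℕ × ℕ))
    (c : ℕ × ℕ → Bool) : Prop where
  lt : ∀ u ∈ S, u.1 < M ∧ u.2 < 90
  card_le : S.card ≤ 8 * M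
  ne : ∀ u v, u.1 < M → u.2 < 90 → v.1 < M → v.2 < 90 → u ∉ S → v ∉ S →
    (grid N M good).Adj u v → c u ≠ c v
  closed : ∀ X : Set (ℕ × ℕ), (∃ u ∈ S, u ∈ X) →
    (∀ u ∈ S, ∀ v ∈ S, u ∈ X → (grid N M good).Adj u v → v ∈ X) → ∀ u ∈ S, u ∈ X

theorem fst_ne_snd_of_mem_innerEdges : ∀ e ∈ innerEdges, e.1 ≠ e.2 := by decide +kernel

theorem lt_of_mem_innerEdges : ∀ e ∈ innerEdges, e.1 < 90 ∧ e.2 < 90 := by decide +kernel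

theorem grid_adj_inner {N M : ℕ} {good : ℕ → ℕ → ℕ → Prop} {a b : ℕ}
    (h : (a, b) ∈ innerEdges) (s : ℕ) : (grid N M good).Adj (s, a) (s, b) := by
  refine (SimpleGraph.fromRel_adj _ _ _).2 ⟨fun h' => ?_, Or.inl (Or.inl ⟨rfl, h⟩)⟩
  exact fst_ne_snd_of_mem_innerEdges _ h (congrArg Prod.snd h')

theorem grid_adj_optional {N M : ℕ} {good : ℕ → ℕ → ℕ → Prop} {t : ℕ} (ht : t < 4) {s : ℕ}
    (h : ¬ good (s / N) (s % N) t) : (grid N M good).Adj (s, t) (s, 78 + 3 * t) := by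
  refine (SimpleGraph.fromRel_adj _ _ _).2 ⟨fun h' => ?_, Or.inl (Or.inr (Or.inl ⟨rfl, ht, h, rfl⟩))⟩
  have := congrArg Prod.snd h'
  simp only at this
  omega

theorem grid_adj_of_link {N M : ℕ} {good : ℕ → ℕ → ℕ → Prop} {s a s' b : ℕ}
    (h : Link N M good s a s' b) (hs : s ≠ s') : (grid N M good).Adj (s, a) (s', b) :=
  (SimpleGraph.fromRel_adj _ _ _).2 ⟨fun h' => hs (congrArg Prod.fst h'), Or.inl h⟩

theorem gadget_edges : ∀ g ∈ orGadgets ++ optionalGadgets,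
    (g.1, 18 + 3 * g.2.2) ∈ innerEdges ∧ (g.2.1, 19 + 3 * g.2.2) ∈ innerEdges ∧
    (19 + 3 * g.2.2, 20 + 3 * g.2.2) ∈ innerEdges ∧ (g.1, 20 + 3 * g.2.2) ∈ innerEdges := by
  decide +kernel

theorem gadget_edge : ∀ g ∈ orGadgets, (g.2.1, 18 + 3 * g.2.2) ∈ innerEdges := by decide +kernel

/-- The inner vertices `18 + 3 o, 19 + 3 o, 20 + 3 o` of gadget `o` are those with quotient `6 + o`
by `3`. They can be left only through the two ends of the gadget. -/
theorem gadget_neighbours : ∀ g ∈ orGadgets ++ optionalGadgets, ∀ e ∈ innerEdges,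
    (e.1 / 3 = 6 + g.2.2 → e.2 / 3 = 6 + g.2.2 ∨ e.2 = g.1 ∨ e.2 = g.2.1) ∧
    (e.2 / 3 = 6 + g.2.2 → e.1 / 3 = 6 + g.2.2 ∨ e.1 = g.1 ∨ e.1 = g.2.1) := by
  decide +kernel

theorem gadget_bounds : ∀ g ∈ orGadgets ++ optionalGadgets,
    g.1 < 12 ∧ g.2.1 < 12 ∧ g.2.2 < 24 ∧ (20 ≤ g.2.2 → g.2.1 = g.2.2 - 20) := by decide +kernel

theorem pendant_neighbours : ∀ e ∈ innerEdges,
    (e.1 = 13 ∨ e.1 = 14 → e.2 = 12 ∨ e.2 = 13 ∨ e.2 = 14) ∧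
    (e.2 = 13 ∨ e.2 = 14 → e.1 = 12 ∨ e.1 = 13 ∨ e.1 = 14) := by decide +kernel

/-- As vertices from `13` on turn out not to be in `S`, an end attaches to the rest of `S` by inner
edges only through `8` or `9`. -/
theorem end_neighbours : ∀ e ∈ innerEdges,
    (e.1 = 4 → e.2 = 8 ∨ 13 ≤ e.2) ∧ (e.2 = 4 → e.1 = 8 ∨ 13 ≤ e.1) ∧
    (e.1 = 5 → e.2 = 9 ∨ 13 ≤ e.2) ∧ (e.2 = 5 → e.1 = 9 ∨ 13 ≤ e.1) := by decide +kernel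

namespace IsSolution

variable {N M : ℕ} {good : ℕ → ℕ → ℕ → Prop} {S : Finset (ℕ × ℕ)} {c : ℕ × ℕ → Bool}

/-- A set that does not contain all of `S` is left by an edge of `S`. -/
theorem exists_adj (h : IsSolution N M good S c) (X : Set (ℕ × ℕ)) {u v : ℕ × ℕ} (hu : u ∈ S)
    (huX : u ∈ X) (hv : v ∈ S) (hvX : v ∉ X) :
    ∃ x ∈ S, x ∈ X ∧ ∃ y ∈ S, y ∉ X ∧ (grid N M good).Adj x y := by
  by_contra! hcon
  refine hvX (h.closed X ⟨u, hu, huX⟩ (fun x hx y hy hxX hxy => ?_) v hv)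
  by_contra hyX
  exact hcon x hx hxX y hy hyX hxy

theorem ne_inner (h : IsSolution N M good S c) {s a b : ℕ} (hs : s < M) (hab : (a, b) ∈ innerEdges)
    (ha : (s, a) ∉ S) (hb : (s, b) ∉ S) : c (s, a) ≠ c (s, b) :=
  h.ne _ _ hs (lt_of_mem_innerEdges _ hab).1 hs (lt_of_mem_innerEdges _ hab).2 ha hb
    (grid_adj_inner hab s)

theorem triangle_mem (h : IsSolution N M good S c) {s : ℕ} (hs : s < M) :
    (s, 12) ∈ S ∨ (s, 13) ∈ S ∨ (s, 14) ∈ S := by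
  by_contra! hcon
  have h₁ := h.ne_inner hs (a := 12) (b := 13) (by decide) hcon.1 hcon.2.1
  have h₂ := h.ne_inner hs (a := 12) (b := 14) (by decide) hcon.1 hcon.2.2
  have h₃ := h.ne_inner hs (a := 13) (b := 14) (by decide) hcon.2.1 hcon.2.2
  generalize c (s, 12) = x₁ at *
  generalize c (s, 13) = x₂ at *
  generalize c (s, 14) = x₃ at *
  revert x₁ x₂ x₃
  decide

/-- `S` meets the triangle `12, 13, 14` of every segment. The vertices `13` and `14` have no
neighbours outside the triangle, so without the root `S` could not reach the triangle of another
segment; `2 ≤ M` provides one. -/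
theorem root_mem (h : IsSolution N M good S c) (hM : 2 ≤ M) {s : ℕ} (hs : s < M) :
    (s, 12) ∈ S := by
  by_contra hr
  obtain ⟨s', hs', hne⟩ : ∃ s' < M, s' ≠ s :=
    ⟨if s = 0 then 1 else 0, by split_ifs <;> omega, by split_ifs <;> omega⟩
  obtain ⟨b, hb⟩ : ∃ b, (s', b) ∈ S := by
    rcases h.triangle_mem hs' with h' | h' | h' <;> exact ⟨_, h'⟩
  obtain ⟨a, ha, haS⟩ : ∃ a, (a = 13 ∨ a = 14) ∧ (s, a) ∈ S := by
    rcases h.triangle_mem hs with h' | h' | h'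
    · exact absurd h' hr
    · exact ⟨13, by simp, h'⟩
    · exact ⟨14, by simp, h'⟩
  obtain ⟨⟨s₁, x⟩, hxS, ⟨hx₁, hx⟩, ⟨s₂, y⟩, hyS, hyX, hadj⟩ :=
    h.exists_adj {u | u.1 = s ∧ (u.2 = 13 ∨ u.2 = 14)} haS ⟨rfl, ha⟩ hb fun h' => hne h'.1
  dsimp only at hx₁ hx
  subst hx₁
  simp only [Set.mem_ofPred_eq, not_and, not_or] at hyX
  have key : s₂ = s₁ ∧ (y = 12 ∨ y = 13 ∨ y = 14) := by
    rcases ((SimpleGraph.fromRel_adj _ _ _).1 hadj).2 with hl | hl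
    · rcases hl with ⟨rfl, hl⟩ | hl | hl | hl | hl | hl | hl | hl
      · exact ⟨rfl, (pendant_neighbours _ hl).1 hx⟩
      all_goals omega
    · rcases hl with ⟨rfl, hl⟩ | hl | hl | hl | hl | hl | hl | hl
      · exact ⟨rfl, (pendant_neighbours _ hl).2 hx⟩
      all_goals omega
  obtain ⟨rfl, hy⟩ := key
  have := hyX rfl
  obtain rfl : y = 12 := by omega
  exact hr hyS

/-- If both ends are missing, either an inner vertex is taken and is then cut off from the root, or
the whole five-cycle survives in the bipartite part. -/
theorem gadget_mem (h : IsSolution N M good S c) (hM : 2 ≤ M) {s : ℕ} (hs : s < M)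
    {g : ℕ × ℕ × ℕ} (hg : g ∈ orGadgets ++ optionalGadgets)
    (hedge : (grid N M good).Adj (s, g.2.1) (s, 18 + 3 * g.2.2)) :
    (s, g.1) ∈ S ∨ (s, g.2.1) ∈ S := by
  by_contra! hcon
  obtain ⟨b₁, b₂, b₃, b₄⟩ := gadget_bounds g hg
  by_cases hq : ∃ a, a / 3 = 6 + g.2.2 ∧ (s, a) ∈ S
  · obtain ⟨a, ha, haS⟩ := hq
    obtain ⟨⟨s₁, x⟩, hxS, ⟨hx₁, hx⟩, ⟨s₂, y⟩, hyS, hyX, hadj⟩ :=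
      h.exists_adj {u | u.1 = s ∧ u.2 / 3 = 6 + g.2.2} haS ⟨rfl, ha⟩ (h.root_mem hM hs)
        fun h' => by
          have := h'.2
          simp only at this
          omega
    dsimp only at hx₁ hx
    subst hx₁
    simp only [Set.mem_ofPred_eq, not_and] at hyX
    have key : s₂ = s₁ ∧ (y / 3 = 6 + g.2.2 ∨ y = g.1 ∨ y = g.2.1) := by
      rcases ((SimpleGraph.fromRel_adj _ _ _).1 hadj).2 with hl | hl
      · rcases hl with ⟨rfl, hl⟩ | hl | hl | hl | hl | hl | hl | hl
        · exact ⟨rfl, (gadget_neighbours g hg _ hl).1 hx⟩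
        all_goals omega
      · rcases hl with ⟨rfl, hl⟩ | hl | hl | hl | hl | hl | hl | hl
        · exact ⟨rfl, (gadget_neighbours g hg _ hl).2 hx⟩
        all_goals omega
    obtain ⟨rfl, hy | rfl | rfl⟩ := key
    · exact hyX rfl hy
    · exact hcon.1 hyS
    · exact hcon.2 hyS
  · push Not at hq
    obtain ⟨e₁, e₂, e₃, e₄⟩ := gadget_edges g hg
    have q₀ := hq (18 + 3 * g.2.2) (by omega)
    have q₁ := hq (19 + 3 * g.2.2) (by omega)
    have q₂ := hq (20 + 3 * g.2.2) (by omega)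
    have n₁ := h.ne_inner hs e₁ hcon.1 q₀
    have n₂ := h.ne_inner hs e₂ hcon.2 q₁
    have n₃ := h.ne_inner hs e₃ q₁ q₂
    have n₄ := h.ne_inner hs e₄ hcon.1 q₂
    have n₅ := h.ne (s, g.2.1) (s, 18 + 3 * g.2.2) hs (by simp only; omega) hs
      (by simp only; omega) hcon.2 q₀ hedge
    generalize c (s, g.1) = x₁ at *
    generalize c (s, g.2.1) = x₂ at *
    generalize c (s, 18 + 3 * g.2.2) = x₃ at *
    generalize c (s, 19 + 3 * g.2.2) = x₄ at *
    generalize c (s, 20 + 3 * g.2.2) = x₅ at *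
    revert x₁ x₂ x₃ x₄ x₅
    decide

theorem or_mem (h : IsSolution N M good S c) (hM : 2 ≤ M) {s : ℕ} (hs : s < M)
    {a b o : ℕ} (hg : (a, b, o) ∈ orGadgets) : (s, a) ∈ S ∨ (s, b) ∈ S :=
  h.gadget_mem hM hs (List.mem_append_left _ hg) (grid_adj_inner (gadget_edge _ hg) s)

theorem or_mem_optional (h : IsSolution N M good S c) (hM : 2 ≤ M) {s : ℕ} (hs : s < M)
    {t : ℕ} (ht : t < 4) (hgood : ¬ good (s / N) (s % N) t) : (s, 11) ∈ S ∨ (s, t) ∈ S := by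
  refine h.gadget_mem hM hs (g := (11, t, 20 + t)) ?_ ?_
  · interval_cases t <;> decide
  · simpa [show 18 + 3 * (20 + t) = 78 + 3 * t by ring] using grid_adj_optional ht hgood

/-- The indicator function of `S`. -/
def ind (S : Finset (ℕ × ℕ)) (s a : ℕ) : ℕ := if (s, a) ∈ S then 1 else 0

theorem ind_le (s a : ℕ) : ind S s a ≤ 1 := by
  unfold ind
  split_ifs <;> simp

theorem ind_eq_zero {s a : ℕ} : ind S s a = 0 ↔ (s, a) ∉ S := by simp [ind]

theorem ind_eq_one {s a : ℕ} : ind S s a = 1 ↔ (s, a) ∈ S := by simp [ind]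

theorem one_le_ind_add_ind (h : IsSolution N M good S c) (hM : 2 ≤ M) {s : ℕ} (hs : s < M)
    {a b : ℕ} (o : ℕ) (hg : (a, b, o) ∈ orGadgets) : 1 ≤ ind S s a + ind S s b := by
  rcases h.or_mem hM hs hg with h' | h'
  · rw [ind_eq_one.2 h']
    omega
  · rw [ind_eq_one.2 h']
    omega

theorem sum_split (s : ℕ) : ∑ a ∈ Finset.range 90, ind S s a =
    ((ind S s 0 + ind S s 1 + ind S s 2 + ind S s 3) + (ind S s 4 + ind S s 6) +
      (ind S s 5 + ind S s 7) + (ind S s 8 + ind S s 9) + (ind S s 10 + ind S s 11) +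
      ind S s 12) + ∑ a ∈ Finset.Ico 13 90, ind S s a := by
  rw [Finset.range_eq_Ico, ← Finset.sum_Ico_consecutive _ (show 0 ≤ 13 by simp)
    (show 13 ≤ 90 by simp), ← Finset.range_eq_Ico]
  simp only [Finset.sum_range_succ, Finset.sum_range_zero]
  ring

/-- The six pairs among `0, …, 3` force three of these vertices, four disjoint pairs force one
vertex each, and the root is the eighth. -/
theorem eight_le_sum (h : IsSolution N M good S c) (hM : 2 ≤ M) {s : ℕ} (hs : s < M) :
    8 ≤ ∑ a ∈ Finset.range 90, ind S s a := by
  rw [sum_split]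
  have h₀ := h.one_le_ind_add_ind hM hs (a := 0) (b := 1) 0 (by decide)
  have h₁ := h.one_le_ind_add_ind hM hs (a := 0) (b := 2) 1 (by decide)
  have h₂ := h.one_le_ind_add_ind hM hs (a := 0) (b := 3) 2 (by decide)
  have h₃ := h.one_le_ind_add_ind hM hs (a := 1) (b := 2) 3 (by decide)
  have h₄ := h.one_le_ind_add_ind hM hs (a := 1) (b := 3) 4 (by decide)
  have h₅ := h.one_le_ind_add_ind hM hs (a := 2) (b := 3) 5 (by decide)
  have h₆ := h.one_le_ind_add_ind hM hs (a := 4) (b := 6) 6 (by decide)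
  have h₇ := h.one_le_ind_add_ind hM hs (a := 5) (b := 7) 7 (by decide)
  have h₈ := h.one_le_ind_add_ind hM hs (a := 8) (b := 9) 8 (by decide)
  have h₉ := h.one_le_ind_add_ind hM hs (a := 10) (b := 11) 9 (by decide)
  have hr := ind_eq_one.2 (h.root_mem hM hs)
  have l₀ := ind_le (S := S) s 0
  have l₁ := ind_le (S := S) s 1
  have l₂ := ind_le (S := S) s 2
  have l₃ := ind_le (S := S) s 3
  omega

theorem card_eq_sum (h : IsSolution N M good S c) :
    S.card = ∑ s ∈ Finset.range M, ∑ a ∈ Finset.range 90, ind S s a := by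
  rw [← Finset.sum_product' (f := fun s a => ind S s a)]
  have : S = (Finset.range M ×ˢ Finset.range 90).filter (· ∈ S) := by
    ext u
    simp only [Finset.mem_filter, Finset.mem_product, Finset.mem_range]
    exact ⟨fun hu => ⟨h.lt u hu, hu⟩, fun hu => hu.2⟩
  conv_lhs => rw [this]
  rw [Finset.card_filter]
  rfl

/-- The budget `8 M` equals the sum of the lower bounds, so no segment can exceed its own. -/
theorem sum_eq_eight (h : IsSolution N M good S c) (hM : 2 ≤ M) {s : ℕ} (hs : s < M) :
    ∑ a ∈ Finset.range 90, ind S s a = 8 := by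
  have hle : ∀ s ∈ Finset.range M, 8 ≤ ∑ a ∈ Finset.range 90, ind S s a :=
    fun s hs => h.eight_le_sum hM (Finset.mem_range.1 hs)
  have hsum : ∑ s ∈ Finset.range M, 8 = ∑ s ∈ Finset.range M, ∑ a ∈ Finset.range 90, ind S s a := by
    refine le_antisymm (Finset.sum_le_sum hle) ?_
    rw [← h.card_eq_sum]
    simpa [mul_comm] using h.card_le
  exact ((Finset.sum_eq_sum_iff_of_le hle).1 hsum s (Finset.mem_range.2 hs)).symm

/-- In every segment, `S` leaves out exactly one of the first four vertices and takes exactly one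
vertex of each of four pairs; apart from these it contains the root only. -/
theorem segment (h : IsSolution N M good S c) (hM : 2 ≤ M) {s : ℕ} (hs : s < M) :
    (∃ t < 4, (s, t) ∉ S ∧ ∀ t' < 4, t' ≠ t → (s, t') ∈ S) ∧
    ((s, 4) ∈ S ↔ (s, 6) ∉ S) ∧ ((s, 5) ∈ S ↔ (s, 7) ∉ S) ∧ ((s, 8) ∈ S ↔ (s, 9) ∉ S) ∧
    ((s, 10) ∈ S ↔ (s, 11) ∉ S) ∧ ∀ a ≥ 13, (s, a) ∉ S := by
  have hsum := h.sum_eq_eight hM hs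
  rw [sum_split] at hsum
  have h₀ := h.one_le_ind_add_ind hM hs (a := 0) (b := 1) 0 (by decide)
  have h₁ := h.one_le_ind_add_ind hM hs (a := 0) (b := 2) 1 (by decide)
  have h₂ := h.one_le_ind_add_ind hM hs (a := 0) (b := 3) 2 (by decide)
  have h₃ := h.one_le_ind_add_ind hM hs (a := 1) (b := 2) 3 (by decide)
  have h₄ := h.one_le_ind_add_ind hM hs (a := 1) (b := 3) 4 (by decide)
  have h₅ := h.one_le_ind_add_ind hM hs (a := 2) (b := 3) 5 (by decide)
  have h₆ := h.one_le_ind_add_ind hM hs (a := 4) (b := 6) 6 (by decide)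
  have h₇ := h.one_le_ind_add_ind hM hs (a := 5) (b := 7) 7 (by decide)
  have h₈ := h.one_le_ind_add_ind hM hs (a := 8) (b := 9) 8 (by decide)
  have h₉ := h.one_le_ind_add_ind hM hs (a := 10) (b := 11) 9 (by decide)
  have hr := ind_eq_one.2 (h.root_mem hM hs)
  have l₀ := ind_le (S := S) s 0
  have l₁ := ind_le (S := S) s 1
  have l₂ := ind_le (S := S) s 2
  have l₃ := ind_le (S := S) s 3
  have hrest : ∑ a ∈ Finset.Ico 13 90, ind S s a = 0 := by omega
  refine ⟨?_, ?_, ?_, ?_, ?_, fun a ha hmem => ?_⟩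
  · have h4 : ∃ t < 4, ind S s t = 0 := by
      by_contra! hcon
      have := hcon 0 (by simp)
      have := hcon 1 (by simp)
      have := hcon 2 (by simp)
      have := hcon 3 (by simp)
      omega
    obtain ⟨t, ht, h0⟩ := h4
    refine ⟨t, ht, ind_eq_zero.1 h0, fun t' ht' hne => ind_eq_one.1 ?_⟩
    interval_cases t <;> interval_cases t' <;> omega
  · rw [← ind_eq_one, ← ind_eq_zero]
    omega
  · rw [← ind_eq_one, ← ind_eq_zero]
    omega
  · rw [← ind_eq_one, ← ind_eq_zero]
    omega
  · rw [← ind_eq_one, ← ind_eq_zero]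
    omega
  · have := ind_eq_zero.1 (Finset.sum_eq_zero_iff.1 hrest a (Finset.mem_Ico.2 ⟨ha, (h.lt _ hmem).2⟩))
    exact this hmem

end IsSolution

end CycleTransversal

/-! ### Types along a path and in a column. -/

namespace CycleTransversal

/-- Type `t` can be followed by type `t'` on the same path. -/
def Follows (t t' : ℕ) : Prop := t = 0 ∨ t' = t ∨ t' = 1

namespace IsSolution

variable {N M : ℕ} {good : ℕ → ℕ → ℕ → Prop} {S : Finset (ℕ × ℕ)} {c : ℕ × ℕ → Bool}

/-- The missing type vertex forces its partners in gadgets `10` to `19`; tightness then excludes the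
other vertex of each pair. -/
theorem left_mem_iff (h : IsSolution N M good S c) (hM : 2 ≤ M) {s t : ℕ} (hs : s < M)
    (ht : t < 4) (htS : (s, t) ∉ S) :
    ((s, 4) ∈ S ↔ t < 2) ∧ ((s, 5) ∈ S ↔ t < 2) ∧ (t = 0 → (s, 8) ∉ S) ∧ (t = 1 → (s, 9) ∉ S) := by
  obtain ⟨-, h₄, h₅, h₈, -, -⟩ := h.segment hM hs
  interval_cases t
  · have a₁ := (h.or_mem hM hs (a := 0) (b := 4) (o := 10) (by decide)).resolve_left htS
    have a₂ := (h.or_mem hM hs (a := 0) (b := 5) (o := 11) (by decide)).resolve_left htS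
    have a₃ := (h.or_mem hM hs (a := 0) (b := 9) (o := 18) (by decide)).resolve_left htS
    simp [a₁, a₂, h₈, a₃]
  · have a₁ := (h.or_mem hM hs (a := 1) (b := 4) (o := 12) (by decide)).resolve_left htS
    have a₂ := (h.or_mem hM hs (a := 1) (b := 5) (o := 13) (by decide)).resolve_left htS
    have a₃ := (h.or_mem hM hs (a := 1) (b := 8) (o := 19) (by decide)).resolve_left htS
    simp [a₁, a₂, h₈.1 a₃]
  · have a₁ := (h.or_mem hM hs (a := 2) (b := 6) (o := 14) (by decide)).resolve_left htS
    have a₂ := (h.or_mem hM hs (a := 2) (b := 7) (o := 15) (by decide)).resolve_left htS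
    simp [h₄, h₅, a₁, a₂]
  · have a₁ := (h.or_mem hM hs (a := 3) (b := 6) (o := 16) (by decide)).resolve_left htS
    have a₂ := (h.or_mem hM hs (a := 3) (b := 7) (o := 17) (by decide)).resolve_left htS
    simp [h₄, h₅, a₁, a₂]

/-- The colours of the two ends of a segment of type `2` or `3`. -/
theorem colour_ends (h : IsSolution N M good S c) (hM : 2 ≤ M) {s t : ℕ} (hs : s < M)
    (ht : t < 4) (htS : (s, t) ∉ S) (h2 : 2 ≤ t) :
    c (s, 4) = (c (s, 16) ^^ decide (t = 2)) ∧ c (s, 5) = (c (s, 16) ^^ decide (t = 2)) := by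
  obtain ⟨m₄, m₅, -, -⟩ := h.left_mem_iff hM hs ht htS
  have n₄ : (s, 4) ∉ S := by rw [m₄]; omega
  have n₅ : (s, 5) ∉ S := by rw [m₅]; omega
  have hp := (h.segment hM hs).2.2.2.2.2
  have n₁₅ := hp 15 (by simp)
  have n₁₆ := hp 16 (by simp)
  have n₁₇ := hp 17 (by simp)
  -- Through `15` both ends get the colour of the selected type vertex. That vertex differs from the
  -- reference `16` if it is `2`, and from its opposite `17` if it is `3`.
  have e₁ := h.ne_inner hs (a := 15) (b := 4) (by decide) n₁₅ n₄
  have e₂ := h.ne_inner hs (a := 15) (b := 5) (by decide) n₁₅ n₅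
  have e₃ := h.ne_inner hs (a := 16) (b := 17) (by decide) n₁₆ n₁₇
  generalize c (s, 4) = x₄ at *
  generalize c (s, 5) = x₅ at *
  obtain rfl | rfl : t = 2 ∨ t = 3 := by omega
  · have e₄ := h.ne_inner hs (a := 15) (b := 2) (by decide) n₁₅ htS
    have e₅ := h.ne_inner hs (a := 2) (b := 16) (by decide) htS n₁₆
    generalize c (s, 2) = x₂ at *
    generalize c (s, 15) = x₁₅ at *
    generalize c (s, 16) = x₁₆ at *
    clear e₃
    revert x₂ x₄ x₅ x₁₅ x₁₆
    decide
  · have e₄ := h.ne_inner hs (a := 15) (b := 3) (by decide) n₁₅ htS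
    have e₅ := h.ne_inner hs (a := 3) (b := 17) (by decide) htS n₁₇
    generalize c (s, 3) = x₃ at *
    generalize c (s, 15) = x₁₅ at *
    generalize c (s, 16) = x₁₆ at *
    generalize c (s, 17) = x₁₇ at *
    cases x₁₅ <;> cases x₁₇ <;> simp_all

/-- The reference vertices form a path outside `S`, so their colours alternate. As `N` is odd, the
reference flips from one column to the next, which matches the edge between consecutive path ends of
equal type. -/
theorem colour_reference (h : IsSolution N M good S c) (hM : 2 ≤ M) {s : ℕ} (k : ℕ)
    (hk : s + k < M) : c (s + k, 16) = (c (s, 16) ^^ decide (k % 2 = 1)) := by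
  induction k with
  | zero => simp
  | succ k ih =>
    have hne := h.ne (s + k, 16) (s + (k + 1), 16) (by simp only; omega) (by simp) hk (by simp)
      ((h.segment hM (by omega)).2.2.2.2.2 16 (by simp))
      ((h.segment hM hk).2.2.2.2.2 16 (by simp))
      (grid_adj_of_link (by simp [Link, add_assoc]) (by omega))
    have ih' := ih (by omega)
    rw [ih'] at hne
    rcases Nat.mod_two_eq_zero_or_one k with hp | hp
    · have : (k + 1) % 2 = 1 := by omega
      simp only [hp, this] at hne ⊢
      revert hne
      generalize c (s, 16) = x
      generalize c (s + (k + 1), 16) = y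
      revert x y
      decide
    · have : (k + 1) % 2 = 0 := by omega
      simp only [hp, this] at hne ⊢
      revert hne
      generalize c (s, 16) = x
      generalize c (s + (k + 1), 16) = y
      revert x y
      decide

/-- Consecutive ends of a path are not taken if both of them are disconnected from the root. -/
theorem ends_notMem (h : IsSolution N M good S c) (hM : 2 ≤ M) (hN : 1 ≤ N) {s : ℕ}
    (hs : s + N < M) (h₅ : (s, 5) ∈ S → (s, 9) ∉ S) (h₄ : (s + N, 4) ∈ S → (s + N, 8) ∉ S) :
    (s, 5) ∉ S ∧ (s + N, 4) ∉ S := by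
  by_contra hcon
  obtain ⟨u, huS, hu⟩ : ∃ u ∈ S, u = (s, 5) ∨ u = (s + N, 4) := by
    by_contra! h'
    exact hcon ⟨fun h₅ => (h' _ h₅).1 rfl, fun h₄ => (h' _ h₄).2 rfl⟩
  -- Some edge of `S` must leave the pair of ends. The attachments `9` and `8` are excluded by
  -- hypothesis, and the direct edges to the root exist only at the outer ends of the path, not on
  -- this link.
  obtain ⟨x, hxS, hx, ⟨s', y⟩, hyS, hyX, hadj⟩ :=
    h.exists_adj {u | u = (s, 5) ∨ u = (s + N, 4)} huS hu
      (h.root_mem hM (show s < M by omega)) (by simp)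
  simp only [Set.mem_ofPred_eq, Prod.mk.injEq, not_or] at hyX
  have hp : ∀ s < M, ∀ a ≥ 13, (s, a) ∉ S := fun s hs => (h.segment hM hs).2.2.2.2.2
  have hadj' := ((SimpleGraph.fromRel_adj _ _ _).1 hadj).2
  have hs' := (h.lt _ hyS).1
  have hy : ¬ 13 ≤ y := fun hy => hp s' hs' y hy hyS
  rcases hx with rfl | rfl
  · have h₉ := h₅ hxS
    rcases hadj' with hl | hl
    · rcases hl with ⟨rfl, hl⟩ | hl | hl | hl | hl | hl | hl | hl
      · rcases (end_neighbours _ hl).2.2.1 rfl with h' | h'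
        · dsimp only at h'
          subst h'
          exact h₉ hyS
        · exact hy h'
      all_goals simp only at hl
      all_goals omega
    · rcases hl with ⟨hl', hl⟩ | hl | hl | hl | hl | hl | hl | hl
      · dsimp only at hl'
        subst hl'
        rcases (end_neighbours _ hl).2.2.2 rfl with h' | h'
        · dsimp only at h'
          subst h'
          exact h₉ hyS
        · exact hy h'
      all_goals simp only at hl
      all_goals omega
  · have h₈ := h₄ hxS
    rcases hadj' with hl | hl
    · rcases hl with ⟨rfl, hl⟩ | hl | hl | hl | hl | hl | hl | hl
      · rcases (end_neighbours _ hl).1 rfl with h' | h'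
        · dsimp only at h'
          subst h'
          exact h₈ hyS
        · exact hy h'
      all_goals simp only at hl
      all_goals omega
    · rcases hl with ⟨hl', hl⟩ | hl | hl | hl | hl | hl | hl | hl
      · dsimp only at hl'
        subst hl'
        rcases (end_neighbours _ hl).2.1 rfl with h' | h'
        · dsimp only at h'
          subst h'
          exact h₈ hyS
        · exact hy h'
      all_goals simp only at hl
      all_goals omega

/-- Otherwise `t ≠ 0` and `t' ≠ 1`, so neither end of the connecting edge is attached to the root
and both must be outside `S`. Both types are then `2` or `3`, and the colours of the two ends force
them to agree. -/
theorem follows (h : IsSolution N M good S c) (hM : 2 ≤ M) (hN : N % 2 = 1) {s t t' : ℕ}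
    (hs : s + N < M) (ht : t < 4) (htS : (s, t) ∉ S) (ht' : t' < 4) (htS' : (s + N, t') ∉ S) :
    Follows t t' := by
  by_contra hcon
  simp only [Follows, not_or] at hcon
  obtain ⟨-, m₅, -, m₉⟩ := h.left_mem_iff hM (show s < M by omega) ht htS
  obtain ⟨m₄, -, m₈, -⟩ := h.left_mem_iff hM hs ht' htS'
  obtain ⟨n₅, n₄⟩ := h.ends_notMem hM (by omega) hs (fun hmem => m₉ (by
    have := m₅.1 hmem
    omega)) (fun hmem => m₈ (by
    have := m₄.1 hmem
    omega))
  have h2 : 2 ≤ t := by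
    rw [m₅] at n₅
    omega
  have h2' : 2 ≤ t' := by
    rw [m₄] at n₄
    omega
  have e₁ := (h.colour_ends hM (show s < M by omega) ht htS h2).2
  have e₂ := (h.colour_ends hM hs ht' htS' h2').1
  have e₃ := h.colour_reference hM (s := s) N hs
  have e₄ := h.ne (s, 5) (s + N, 4) (by simp only; omega) (by simp) hs (by simp) n₅ n₄
    (grid_adj_of_link (by simp [Link]) (by omega))
  rw [e₁, e₂, e₃, hN] at e₄
  generalize c (s, 16) = x at *
  obtain ⟨rfl, rfl⟩ | ⟨rfl, rfl⟩ : (t = 2 ∧ t' = 3) ∨ (t = 3 ∧ t' = 2) := by omega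
  all_goals
    clear e₁ e₂ e₃
    revert x
    decide

/-- In every column, one of the vertices of the odd cycle is taken. -/
theorem exists_cycle_mem (h : IsSolution N M good S c) (hN : N % 2 = 1) (hN3 : 3 ≤ N) {j : ℕ}
    (hj : j * N + N ≤ M) : ∃ i < N, (j * N + i, 10) ∈ S := by
  by_contra! hcon
  -- Colours would alternate along the column, so positions `0` and `N - 1`, which are adjacent,
  -- would have the same colour.
  have key : ∀ i < N, c (j * N + i, 10) = (c (j * N, 10) ^^ decide (i % 2 = 1)) := by
    intro i
    induction i with
    | zero => simp
    | succ i ih =>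
      intro hi
      have hmod : (j * N + (i + 1)) % N ≠ 0 := by
        rw [Nat.mul_add_mod', Nat.mod_eq_of_lt hi]
        omega
      have hne := h.ne (j * N + i, 10) (j * N + (i + 1), 10) (by simp only; omega) (by simp)
        (by simp only; omega) (by simp) (hcon i (by omega)) (hcon (i + 1) hi)
        (grid_adj_of_link (Or.inr (Or.inr (Or.inr (Or.inr (Or.inr (Or.inl
          ⟨by omega, hmod, rfl, rfl⟩)))))) (by omega))
      rw [ih (by omega)] at hne
      rcases Nat.mod_two_eq_zero_or_one i with hp | hp
      · have : (i + 1) % 2 = 1 := by omega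
        simp only [hp, this] at hne ⊢
        revert hne
        generalize c (j * N, 10) = x
        generalize c (j * N + (i + 1), 10) = y
        revert x y
        decide
      · have : (i + 1) % 2 = 0 := by omega
        simp only [hp, this] at hne ⊢
        revert hne
        generalize c (j * N, 10) = x
        generalize c (j * N + (i + 1), 10) = y
        revert x y
        decide
  have hlast := key (N - 1) (by omega)
  have hne := h.ne (j * N, 10) (j * N + (N - 1), 10) (by simp only; omega) (by simp)
    (by simp only; omega) (by simp) (hcon 0 (by omega)) (hcon (N - 1) (by omega))
    (grid_adj_of_link (Or.inr (Or.inr (Or.inr (Or.inr (Or.inr (Or.inr (Or.inl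
      ⟨by omega, by simp, rfl, rfl⟩))))))) (by omega))
  rw [hlast, show (N - 1) % 2 = 0 by omega] at hne
  simp at hne

/-- A solution selects a type for every segment; types on a path change in one direction only, and
in every column a good type is selected. -/
theorem exists_types {Q : ℕ} (h : IsSolution N (N * Q) good S c) (hN : N % 2 = 1) (hN3 : 3 ≤ N)
    (hQ : 1 ≤ Q) : ∃ τ : ℕ → ℕ → ℕ, (∀ j < Q, ∀ i < N, τ j i < 4) ∧
      (∀ j, j + 1 < Q → ∀ i < N, Follows (τ j i) (τ (j + 1) i)) ∧
      ∀ j < Q, ∃ i < N, good j i (τ j i) := by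
  have hM : 2 ≤ N * Q := by nlinarith
  have hlt : ∀ j < Q, j * N + N ≤ N * Q := fun j hj => by nlinarith
  choose! τ hτ hτS hτ' using fun (s : ℕ) (hs : s < N * Q) => (h.segment hM hs).1
  refine ⟨fun j i => τ (j * N + i), fun j hj i hi => ?_, fun j hj i hi => ?_, fun j hj => ?_⟩
  · have := hlt j hj
    exact hτ _ (by omega)
  · have h₁ := hlt (j + 1) hj
    have h₂ : (j + 1) * N + i = j * N + i + N := by ring
    have h₃ : (j + 1) * N = j * N + N := by ring
    simp only [h₂]
    exact h.follows hM hN (by omega) (hτ _ (by omega)) (hτS _ (by omega)) (hτ _ (by omega))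
      (hτS _ (by omega))
  · have h₁ := hlt j hj
    obtain ⟨i, hi, hmem⟩ := h.exists_cycle_mem hN hN3 h₁
    refine ⟨i, hi, ?_⟩
    have hs : j * N + i < N * Q := by omega
    by_contra hgood
    have hdiv : (j * N + i) / N = j := by
      rw [mul_comm, Nat.mul_add_div (by omega), Nat.div_eq_of_lt hi, add_zero]
    have hmod : (j * N + i) % N = i := by
      rw [Nat.mul_add_mod', Nat.mod_eq_of_lt hi]
    -- A bad type activates the gadget on `11` and the type vertex, but the latter is missing, and
    -- `11` is missing because `10` is taken.
    rcases h.or_mem_optional hM hs (hτ _ hs) (by rwa [hdiv, hmod]) with h' | h'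
    · exact (h.segment hM hs).2.2.2.2.1.1 hmem h'
    · exact hτS _ hs h'

end IsSolution

end CycleTransversal

/-! ### The solution built from types that are constant along paths. -/

namespace CycleTransversal

/-- Membership in the solution of vertex `a` of a segment of type `t`; the cycle vertex of the
segment is taken if `pin` is true. -/
def taken (t : ℕ) (pin : Bool) (a : ℕ) : Bool :=
  if a < 4 then a ≠ t
  else if a < 6 then t < 2
  else if a < 8 then 2 ≤ t
  else if a = 8 then t ≠ 0
  else if a = 9 then t = 0
  else if a = 10 then pin
  else if a = 11 then !pin
  else a = 12

/-- The colour of vertex `a < 18` of a segment of type `t` with reference colour `f`; the colour of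
the cycle vertex is `p`. -/
def baseColour (t : ℕ) (f p : Bool) (a : ℕ) : Bool :=
  if a < 6 then f ^^ (t = 2)
  else if a = 9 then !(f ^^ (t = 2))
  else if a = 10 then p
  else if a = 11 then !(f ^^ (t = 2))
  else if a = 13 then !f
  else if a = 15 then !(f ^^ (t = 2))
  else if a = 17 then !f
  else f

/-- The colour of vertex `a` of a segment. -/
def localColour (t : ℕ) (f p pin : Bool) (a : ℕ) : Bool :=
  if a < 18 then baseColour t f p a
  else
    let g := (orGadgets ++ optionalGadgets).getD ((a - 18) / 3) (0, 0, 0)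
    let x := baseColour t f p g.1
    let y := baseColour t f p g.2.1
    if taken t pin g.1 then y ^^ (a % 3 ≠ 2)
    else if taken t pin g.2.1 then x ^^ (a % 3 ≠ 1)
    else if a % 3 = 0 then !x
    else if a % 3 = 1 then !y
    else y

/-- If one end of a gadget is taken, its inner path is coloured from the other end. If neither is,
which occurs only for optional gadgets, the colour of `11` is opposite to that of the type vertex,
as the remaining path of length three requires. -/
theorem localColour_inner : ∀ t < 4, ∀ f p pin : Bool, ∀ e ∈ innerEdges,
    taken t pin e.1 = false → taken t pin e.2 = false →
    localColour t f p pin e.1 ≠ localColour t f p pin e.2 := by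
  decide +kernel

/-- The only untaken `a < 4` is the selected type. With `pin = false` vertex `11` is taken, and the
extra edge does no harm; a pinned segment has a good type and lacks this edge. -/
theorem localColour_optional : ∀ t < 4, ∀ f p pin : Bool, ∀ a < 4, (a = t → pin = false) →
    taken t pin a = false → localColour t f p pin a ≠ localColour t f p pin (78 + 3 * a) := by
  decide +kernel

theorem localColour_ends : ∀ t < 4, ∀ f p p' pin pin' : Bool, taken t pin 5 = false →
    localColour t f p pin 5 ≠ localColour t (!f) p' pin' 4 := by
  decide +kernel

theorem card_taken : ∀ t < 4, ∀ pin : Bool,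
    ((Finset.range 90).filter fun a => taken t pin a = true).card = 8 := by
  decide +kernel

theorem taken_cases : ∀ t < 4, ∀ pin : Bool, ∀ a ∈ Finset.range 90, taken t pin a = true →
    (12, a) ∈ innerEdges ∨ a ∈ [12, 4, 5] := by
  decide +kernel

variable {N Q : ℕ} {good : ℕ → ℕ → ℕ → Prop} (τ w : ℕ → ℕ)

/-- The solution with type `τ i` on path `i` that takes cycle vertex `w j` in column `j`. -/
def solution (N Q : ℕ) (τ w : ℕ → ℕ) : Finset (ℕ × ℕ) :=
  (Finset.range (N * Q) ×ˢ Finset.range 90).filter fun u =>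
    taken (τ (u.1 % N)) (u.1 % N = w (u.1 / N)) u.2 = true

/-- The colour of the cycle vertex of segment `s`. -/
def cycleColour (N : ℕ) (w : ℕ → ℕ) (s : ℕ) : Bool :=
  (s % N + if s % N < w (s / N) then 1 else 0) % 2 = 1

/-- The colouring of the vertices that are not in the solution. -/
def solutionColour (N : ℕ) (τ w : ℕ → ℕ) (u : ℕ × ℕ) : Bool :=
  localColour (τ (u.1 % N)) (u.1 % 2 = 1) (cycleColour N w u.1) (u.1 % N = w (u.1 / N)) u.2

theorem mem_solution {s a : ℕ} : (s, a) ∈ solution N Q τ w ↔ s < N * Q ∧ a < 90 ∧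
    taken (τ (s % N)) (s % N = w (s / N)) a = true := by
  simp [solution, and_assoc]

theorem taken_eq_false {s a : ℕ} (hs : s < N * Q) (ha : a < 90) (h : (s, a) ∉ solution N Q τ w) :
    taken (τ (s % N)) (s % N = w (s / N)) a = false := by
  by_contra hcon
  exact h ((mem_solution τ w).2 ⟨hs, ha, by simpa using hcon⟩)

theorem solutionColour_ne (hN : N % 2 = 1) (hN3 : 3 ≤ N) (hτ : ∀ i < N, τ i < 4)
    (hw : ∀ j < Q, w j < N ∧ good j (w j) (τ (w j))) {s a s' b : ℕ} (hs : s < N * Q) (ha : a < 90)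
    (hs' : s' < N * Q) (hb : b < 90) (haS : (s, a) ∉ solution N Q τ w)
    (hbS : (s', b) ∉ solution N Q τ w) (hl : Link N (N * Q) good s a s' b) :
    solutionColour N τ w (s, a) ≠ solutionColour N τ w (s', b) := by
  have hN0 : 0 < N := by omega
  have ta := taken_eq_false τ w hs ha haS
  have tb := taken_eq_false τ w hs' hb hbS
  have ht := hτ (s % N) (Nat.mod_lt _ hN0)
  have hj : s / N < Q := Nat.div_lt_of_lt_mul hs
  rcases hl with ⟨rfl, hl⟩ | ⟨rfl, h4, hg, rfl⟩ | ⟨rfl, -, -, rfl⟩ | ⟨rfl, -, -, rfl⟩ |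
    ⟨rfl, rfl | rfl, rfl⟩ | ⟨rfl, hmod, rfl, rfl⟩ | ⟨hss, hmod, rfl, rfl⟩ | ⟨rfl, rfl, rfl⟩
  · exact localColour_inner _ ht _ _ _ _ hl ta tb
  · refine localColour_optional _ ht _ _ _ _ h4 (fun h => ?_) ta
    simp only [decide_eq_false_iff_not]
    intro h'
    dsimp only at h
    rw [h, h'] at hg
    exact hg (hw _ hj).2
  · simp [taken] at tb
  · simp [taken] at tb
  · simp [taken] at tb
  · simp only [solutionColour, localColour, baseColour]
    rcases Nat.mod_two_eq_zero_or_one s with h | h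
    · simp [h, show (s + 1) % 2 = 1 by omega]
    · simp [h, show (s + 1) % 2 = 0 by omega]
  · have hlt : s % N + 1 < N := by
      have := Nat.mod_lt s hN0
      rcases Nat.lt_or_ge (s % N + 1) N with h | h
      · exact h
      · refine absurd ?_ hmod
        rw [Nat.add_mod, Nat.mod_eq_of_lt (by omega : 1 < N), show s % N + 1 = N by omega,
          Nat.mod_self]
    have hm : (s + 1) % N = s % N + 1 := by
      rw [Nat.add_mod, Nat.mod_eq_of_lt (by omega : 1 < N), Nat.mod_eq_of_lt hlt]
    have hd : (s + 1) / N = s / N := by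
      have h₁ := Nat.div_add_mod s N
      refine Nat.div_eq_of_lt_le ?_ ?_
      · rw [mul_comm]
        omega
      · rw [add_mul, mul_comm]
        omega
    have na : s % N ≠ w (s / N) := by simpa [taken] using ta
    have nb : s % N + 1 ≠ w (s / N) := by simpa [taken, hm, hd] using tb
    -- Neither position is `w`, so both lie on the same side of it and receive the same shift in
    -- `cycleColour`.
    simp only [solutionColour, localColour, baseColour, cycleColour, hm, hd]
    simp only [ne_eq, Nat.reduceLT, if_true, if_false, Nat.reduceEqDiff, decide_eq_decide]
    split_ifs <;> omega
  · have hm : s' % N = N - 1 := by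
      rw [show s' = s + (N - 1) by omega, Nat.add_mod, hmod, zero_add, Nat.mod_mod,
        Nat.mod_eq_of_lt (by omega)]
    have hd : s' / N = s / N := by
      have h₁ := Nat.div_add_mod s N
      refine Nat.div_eq_of_lt_le ?_ ?_
      · rw [mul_comm]
        omega
      · rw [add_mul, mul_comm]
        omega
    have hwlt := (hw _ hj).1
    have na : 0 ≠ w (s / N) := by simpa [taken, hmod] using ta
    have nb : N - 1 ≠ w (s / N) := by simpa [taken, hm, hd] using tb
    -- Position `0` is below `w` and `N - 1` above it, so the values compared modulo two are `1` and
    -- the even number `N - 1`.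
    simp only [solutionColour, localColour, baseColour, cycleColour, hm, hd, hmod]
    simp only [ne_eq, Nat.reduceLT, if_true, if_false, Nat.reduceEqDiff, decide_eq_decide]
    split_ifs <;> omega
  · have hf : decide ((s + N) % 2 = 1) = !decide (s % 2 = 1) := by
      rw [← decide_not, decide_eq_decide]
      omega
    simp only [solutionColour, Nat.add_mod_right, hf]
    exact localColour_ends _ ht _ _ _ _ _ ta

theorem card_solution (hN : 0 < N) (hτ : ∀ i < N, τ i < 4) :
    (solution N Q τ w).card = 8 * (N * Q) := by
  rw [solution, Finset.card_filter, Finset.sum_product]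
  have : ∀ s ∈ Finset.range (N * Q), (∑ a ∈ Finset.range 90,
      if taken (τ (s % N)) (s % N = w (s / N)) a = true then 1 else 0) = 8 := by
    intro s _
    rw [← Finset.card_filter]
    exact card_taken _ (hτ _ (Nat.mod_lt _ hN)) _
  rw [Finset.sum_congr rfl this]
  simp [mul_comm]

/-- The roots form a path, and every taken vertex except the ends is a root or adjacent to one. In
type `0` a left end reaches the root through the previous right end, or directly in the first
column; type `1` is the mirror image. This uses that the type is the same in all columns. -/
theorem solution_closed (hN3 : 3 ≤ N) (hτ : ∀ i < N, τ i < 4) (X : Set (ℕ × ℕ))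
    (hX : ∃ u ∈ solution N Q τ w, u ∈ X)
    (hcl : ∀ u ∈ solution N Q τ w, ∀ v ∈ solution N Q τ w, u ∈ X →
      (grid N (N * Q) good).Adj u v → v ∈ X) : ∀ u ∈ solution N Q τ w, u ∈ X := by
  have hN0 : 0 < N := by omega
  have hiff : ∀ u ∈ solution N Q τ w, ∀ v ∈ solution N Q τ w, (grid N (N * Q) good).Adj u v →
      (u ∈ X ↔ v ∈ X) :=
    fun u hu v hv h => ⟨fun hX => hcl u hu v hv hX h, fun hX => hcl v hv u hu hX h.symm⟩
  have ht : ∀ s, τ (s % N) < 4 := fun s => hτ _ (Nat.mod_lt _ hN0)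
  have root : ∀ s < N * Q, (s, 12) ∈ solution N Q τ w := fun s hs =>
    (mem_solution τ w).2 ⟨hs, by simp, by simp [taken]⟩
  have chain : ∀ s, s < N * Q → ((s, 12) ∈ X ↔ (0, 12) ∈ X) := by
    intro s
    induction s with
    | zero => simp
    | succ s ih =>
      intro hs
      rw [← ih (by omega)]
      exact (hiff _ (root s (by omega)) _ (root _ hs)
        (grid_adj_of_link (by simp [Link]) (by omega))).symm
  have nine : ∀ s < N * Q, τ (s % N) = 0 → (s, 9) ∈ solution N Q τ w := fun s hs h =>
    (mem_solution τ w).2 ⟨hs, by simp, by simp [taken, h]⟩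
  have eight : ∀ s < N * Q, τ (s % N) = 1 → (s, 8) ∈ solution N Q τ w := fun s hs h =>
    (mem_solution τ w).2 ⟨hs, by simp, by simp [taken, h]⟩
  have four : ∀ s < N * Q, τ (s % N) < 2 → (s, 4) ∈ solution N Q τ w := fun s hs h =>
    (mem_solution τ w).2 ⟨hs, by simp, by simp [taken, h]⟩
  have five : ∀ s < N * Q, τ (s % N) < 2 → (s, 5) ∈ solution N Q τ w := fun s hs h =>
    (mem_solution τ w).2 ⟨hs, by simp, by simp [taken, h]⟩
  have inner : ∀ s < N * Q, ∀ a, (s, a) ∈ solution N Q τ w → (12, a) ∈ innerEdges →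
      ((s, a) ∈ X ↔ (s, 12) ∈ X) := fun s hs a ha h =>
    (hiff _ (root s hs) _ ha (grid_adj_inner h s)).symm
  have four₁ : ∀ s < N * Q, τ (s % N) = 1 → ((s, 4) ∈ X ↔ (s, 12) ∈ X) := by
    intro s hs h
    rw [← inner s hs 8 (eight s hs h) (by decide)]
    exact hiff _ (four s hs (by omega)) _ (eight s hs h) (grid_adj_inner (by decide) s)
  have five₀ : ∀ s < N * Q, τ (s % N) = 0 → ((s, 5) ∈ X ↔ (s, 12) ∈ X) := by
    intro s hs h
    rw [← inner s hs 9 (nine s hs h) (by decide)]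
    exact hiff _ (five s hs (by omega)) _ (nine s hs h) (grid_adj_inner (by decide) s)
  have adj₁ : ∀ {s a}, Link N (N * Q) good s a s 12 → a ≠ 12 →
      (grid N (N * Q) good).Adj (s, a) (s, 12) := fun {s a} h hne =>
    (SimpleGraph.fromRel_adj _ _ _).2 ⟨fun h' => hne (congrArg Prod.snd h'), Or.inl h⟩
  have all : ∀ u ∈ solution N Q τ w, (u ∈ X ↔ (0, 12) ∈ X) := by
    rintro ⟨s, a⟩ hu
    obtain ⟨hs, ha, hta⟩ := (mem_solution τ w).1 hu
    rw [← chain s hs]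
    rcases taken_cases _ (ht s) _ a (Finset.mem_range.2 ha) hta with h | h
    · exact inner s hs a hu h
    simp only [List.mem_cons, List.not_mem_nil, or_false] at h
    obtain rfl | rfl | rfl := h
    · rfl
    · have h : τ (s % N) < 2 := by simpa [taken] using hta
      obtain h | h : τ (s % N) = 0 ∨ τ (s % N) = 1 := by omega
      · rcases Nat.lt_or_ge s N with hsN | hsN
        · exact hiff _ hu _ (root s hs)
            (adj₁ (Or.inr (Or.inr (Or.inl ⟨rfl, hsN, rfl, rfl⟩))) (by simp))
        · obtain ⟨r, rfl⟩ := Nat.exists_eq_add_of_le' hsN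
          rw [Nat.add_mod_right] at h
          rw [chain _ hs, ← chain r (by omega), ← five₀ r (by omega) h]
          exact (hiff _ (five r (by omega) (by omega)) _ hu
            (grid_adj_of_link (by simp [Link]) (by omega))).symm
      · exact four₁ s hs h
    · have h : τ (s % N) < 2 := by simpa [taken] using hta
      obtain h | h : τ (s % N) = 0 ∨ τ (s % N) = 1 := by omega
      · exact five₀ s hs h
      · rcases Nat.lt_or_ge (s + N) (N * Q) with hsN | hsN
        · have h' : τ ((s + N) % N) = 1 := by rwa [Nat.add_mod_right]
          rw [chain _ hs, ← chain (s + N) hsN, ← four₁ (s + N) hsN h']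
          exact hiff _ hu _ (four _ hsN (by omega)) (grid_adj_of_link (by simp [Link]) (by omega))
        · exact hiff _ hu _ (root s hs)
            (adj₁ (Or.inr (Or.inr (Or.inr (Or.inl ⟨rfl, hsN, rfl, rfl⟩)))) (by simp))
  obtain ⟨u, hu, huX⟩ := hX
  exact fun v hv => (all v hv).2 ((all u hu).1 huX)

theorem isSolution_solution (hN : N % 2 = 1) (hN3 : 3 ≤ N) (hτ : ∀ i < N, τ i < 4)
    (hw : ∀ j < Q, w j < N ∧ good j (w j) (τ (w j))) :
    IsSolution N (N * Q) good (solution N Q τ w) (solutionColour N τ w) where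
  lt u hu := by
    obtain ⟨h₁, h₂, -⟩ := (mem_solution τ w).1 hu
    exact ⟨h₁, h₂⟩
  card_le := (card_solution τ w (by omega) hτ).le
  ne u v hu₁ hu₂ hv₁ hv₂ hu hv hadj := by
    rcases ((SimpleGraph.fromRel_adj _ _ _).1 hadj).2 with hl | hl
    · exact solutionColour_ne τ w hN hN3 hτ hw hu₁ hu₂ hv₁ hv₂ hu hv hl
    · exact (solutionColour_ne τ w hN hN3 hτ hw hv₁ hv₂ hu₁ hu₂ hv hu hl).symm
  closed := solution_closed τ w hN3 hτ

end CycleTransversal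

/-! ### Reformulation of the problem and transfer to a graph on `Fin`. -/

namespace SimpleGraph

variable {V : Type*} {G : SimpleGraph V}

theorem isBipartite_induce_compl_iff {S : Set V} : (G.induce Sᶜ).IsBipartite ↔
    ∃ c : V → Bool, ∀ u v, u ∉ S → v ∉ S → G.Adj u v → c u ≠ c v := by
  classical
  constructor
  · rintro ⟨C⟩
    refine ⟨fun u => if h : u ∉ S then C ⟨u, h⟩ = 0 else false, fun u v hu hv huv => ?_⟩
    have hne : C ⟨u, hu⟩ ≠ C ⟨v, hv⟩ := C.valid (show (G.induce Sᶜ).Adj ⟨u, hu⟩ ⟨v, hv⟩ from huv)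
    simp only [hu, hv, not_false_eq_true, dif_pos, ne_eq, decide_eq_decide]
    omega
  · rintro ⟨c, hc⟩
    refine ⟨Coloring.mk (fun u => if c u then 0 else 1) fun {u v} huv => ?_⟩
    have := hc u v u.2 v.2 huv
    cases hu : c u <;> cases hv : c v <;> simp_all

/-- In this form connectivity moves easily along an injection, and it is refuted by a set that no
edge of `S` leaves. For the converse, the closed set is the set of vertices reachable from a given
one. -/
theorem connected_induce_iff_forall_closed {S : Set V} : (G.induce S).Connected ↔ S.Nonempty ∧
    ∀ X : Set V, (∃ u ∈ S, u ∈ X) → (∀ u ∈ S, ∀ v ∈ S, u ∈ X → G.Adj u v → v ∈ X) →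
      ∀ u ∈ S, u ∈ X := by
  rw [connected_iff]
  constructor
  · rintro ⟨hpre, ⟨x⟩⟩
    refine ⟨⟨x, x.2⟩, ?_⟩
    rintro X ⟨u, hu, huX⟩ hcl v hv
    have hreach := (reachable_iff_reflTransGen _ _).1 (hpre ⟨u, hu⟩ ⟨v, hv⟩)
    have : ∀ y : S, Relation.ReflTransGen (G.induce S).Adj ⟨u, hu⟩ y → (y : V) ∈ X := by
      intro y hy
      induction hy with
      | refl => exact huX
      | tail _ hadj ih => exact hcl _ (Subtype.coe_prop _) _ (Subtype.coe_prop _) ih hadj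
    exact this _ hreach
  · rintro ⟨⟨x, hx⟩, hcl⟩
    refine ⟨fun u v => ?_, ⟨⟨x, hx⟩⟩⟩
    obtain ⟨_, h⟩ := hcl {y | ∃ h : y ∈ S, (G.induce S).Reachable u ⟨y, h⟩}
      ⟨u, u.2, u.2, Reachable.refl _⟩ (by
        rintro y hy z hz ⟨_, hr⟩ hyz
        exact ⟨hz, hr.trans (Adj.reachable (show (G.induce S).Adj ⟨y, hy⟩ ⟨z, hz⟩ from hyz))⟩) v v.2
    exact h

end SimpleGraph

namespace CycleTransversal

/-- The segment of a vertex and its position in the segment. -/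
def position (M : ℕ) (u : Fin (M * 90)) : ℕ × ℕ := ((u : ℕ) / 90, (u : ℕ) % 90)

/-- The first `M` segments of the grid, with budget `8 M`. -/
def gridInstance (N M : ℕ) (good : ℕ → ℕ → ℕ → Prop) : GraphWithBudget where
  n := M * 90
  G := (grid N M good).comap (position M)
  k := 8 * M

theorem position_injective (M : ℕ) : Function.Injective (position M) := by
  intro u v h
  have h₁ := congrArg Prod.fst h
  have h₂ := congrArg Prod.snd h
  simp only [position] at h₁ h₂
  exact Fin.ext (by omega)

theorem position_lt {M : ℕ} (u : Fin (M * 90)) : (position M u).1 < M ∧ (position M u).2 < 90 := by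
  have := u.2
  simp only [position]
  omega

theorem exists_position_eq {M : ℕ} {x : ℕ × ℕ} (h₁ : x.1 < M) (h₂ : x.2 < 90) :
    ∃ u, position M u = x := by
  refine ⟨⟨x.1 * 90 + x.2, by omega⟩, ?_⟩
  ext
  · simp only [position]
    omega
  · simp only [position]
    omega

theorem exists_isConnectedOCT_iff {N M : ℕ} {good : ℕ → ℕ → ℕ → Prop} (hM : 0 < M) :
    (∃ S : Finset (Fin (M * 90)), S.card ≤ 8 * M ∧
      ((grid N M good).comap (position M)).IsConnectedOCT (S : Set (Fin (M * 90)))) ↔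
    ∃ S c, IsSolution N M good S c := by
  classical
  simp only [SimpleGraph.IsConnectedOCT,
    SimpleGraph.isBipartite_induce_compl_iff, SimpleGraph.connected_induce_iff_forall_closed]
  constructor
  · rintro ⟨S, hk, ⟨c, hc⟩, hne, hcl⟩
    have : Nonempty (Fin (M * 90)) := ⟨⟨0, by omega⟩⟩
    have hinv : ∀ u, Function.invFun (position M) (position M u) = u :=
      Function.leftInverse_invFun (position_injective M)
    have hmem : ∀ u, position M u ∈ S.image (position M) ↔ u ∈ S := fun u =>
      Finset.mem_image.trans ⟨fun ⟨v, hv, h⟩ => position_injective M h ▸ hv, fun h => ⟨u, h, rfl⟩⟩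
    refine ⟨S.image (position M), fun x => c (Function.invFun (position M) x), ?_, ?_, ?_, ?_⟩
    · intro x hx
      obtain ⟨u, -, rfl⟩ := Finset.mem_image.1 hx
      exact position_lt u
    · exact Finset.card_image_le.trans hk
    · intro x y hx₁ hx₂ hy₁ hy₂ hx hy hadj
      obtain ⟨u, rfl⟩ := exists_position_eq hx₁ hx₂
      obtain ⟨v, rfl⟩ := exists_position_eq hy₁ hy₂
      simp only [hinv]
      exact hc u v (fun h => hx ((hmem u).2 h)) (fun h => hy ((hmem v).2 h)) hadj
    · rintro X ⟨x, hx, hxX⟩ hX y hy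
      obtain ⟨u, hu, rfl⟩ := Finset.mem_image.1 hx
      obtain ⟨v, hv, rfl⟩ := Finset.mem_image.1 hy
      exact hcl (position M ⁻¹' X) ⟨u, hu, hxX⟩ (fun u hu v hv h hadj =>
        hX _ ((hmem u).2 hu) _ ((hmem v).2 hv) h hadj) v hv
  · rintro ⟨S, c, h⟩
    have hS : (S.preimage (position M) (position_injective M).injOn).image (position M) = S := by
      rw [Finset.image_preimage, Finset.filter_eq_self]
      intro x hx
      exact exists_position_eq (h.lt x hx).1 (h.lt x hx).2
    refine ⟨S.preimage (position M) (position_injective M).injOn, ?_, ⟨fun u => c (position M u), ?_⟩,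
      ?_, ?_⟩
    · rw [← Finset.card_image_of_injective _ (position_injective M), hS]
      exact h.card_le
    · intro u v hu hv hadj
      have hu' := position_lt u
      have hv' := position_lt v
      exact h.ne _ _ hu'.1 hu'.2 hv'.1 hv'.2 (by simpa using hu) (by simpa using hv) hadj
    · obtain ⟨a, ha⟩ : ∃ a, (0, a) ∈ S := by
        rcases h.triangle_mem hM with h' | h' | h' <;> exact ⟨_, h'⟩
      obtain ⟨u, hu⟩ := exists_position_eq (h.lt _ ha).1 (h.lt _ ha).2
      exact ⟨u, by simpa [hu] using ha⟩
    · rintro X ⟨u, hu, huX⟩ hX v hv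
      obtain ⟨v', hv', hvv⟩ := h.closed (position M '' X) ⟨_, by simpa using hu, u, huX, rfl⟩ (by
        rintro x hx y hy ⟨u, huX, rfl⟩ hadj
        obtain ⟨v, rfl⟩ := exists_position_eq (h.lt y hy).1 (h.lt y hy).2
        exact ⟨v, hX u (by simpa using hx) v (by simpa using hy) huX hadj, rfl⟩) (position M v)
        (by simpa using hv)
      exact position_injective M hvv ▸ hv'

/-! ### Satisfying assignments and solutions. -/

/-- Type `t` on path `i` satisfies clause `j` modulo the number of clauses plus one; there the last
clause is trivial. The type encodes the values of the variables `2 i` and `2 i + 1`. -/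
def Good (φ : CNFFormula) (j i t : ℕ) : Prop :=
  ∀ cl, φ.clauses[j % (φ.clauses.length + 1)]? = some cl →
    ∃ l ∈ cl, 2 * (l.1 : ℕ) + l.2.toNat = 4 * i + t % 2 ∨
      2 * (l.1 : ℕ) + l.2.toNat = 4 * i + 2 + t / 2

/-- The number of paths, an odd number. -/
def numPaths (n : ℕ) : ℕ := 2 * (n / 4) + 3

/-- The number of columns. -/
def numColumns (φ : CNFFormula) : ℕ := (2 * numPaths φ.numVars + 2) * (φ.clauses.length + 1)

theorem exists_isSolution_of_satisfiable {φ : CNFFormula} (h : φ.Satisfiable) :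
    ∃ S c, IsSolution (numPaths φ.numVars) (numPaths φ.numVars * numColumns φ) (Good φ) S c := by
  obtain ⟨v, hv⟩ := h
  set x : ℕ → Bool := fun k => if h : k < φ.numVars then v ⟨k, h⟩ else false with hx
  -- The value of variable `2 i` is the low bit and that of `2 i + 1` the high bit; indices beyond
  -- the last variable count as false.
  set τ : ℕ → ℕ := fun i => (x (2 * i)).toNat + 2 * (x (2 * i + 1)).toNat with hτ
  have hgood : ∀ j, ∃ i < numPaths φ.numVars, Good φ j i (τ i) := by
    intro j
    cases hcl : φ.clauses[j % (φ.clauses.length + 1)]? with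
    | none => exact ⟨0, by simp [numPaths], by simp [Good, hcl]⟩
    | some cl =>
      obtain ⟨l, hl, hlv⟩ := hv cl (List.mem_of_getElem? hcl)
      have hlt := l.1.2
      refine ⟨(l.1 : ℕ) / 2, by simp only [numPaths]; omega, fun cl' hcl' => ⟨l, ?_, ?_⟩⟩
      · rw [hcl] at hcl'
        exact Option.some.inj hcl' ▸ hl
      · have hxl : x l.1 = l.2 := by simp [hx, hlv]
        have b₀ := Bool.toNat_le (x (2 * ((l.1 : ℕ) / 2)))
        have b₁ := Bool.toNat_le (x (2 * ((l.1 : ℕ) / 2) + 1))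
        rcases Nat.mod_two_eq_zero_or_one l.1 with hp | hp
        · left
          have hl₂ : x (2 * ((l.1 : ℕ) / 2)) = l.2 := by
            rw [show 2 * ((l.1 : ℕ) / 2) = l.1 by omega, hxl]
          simp only [hτ]
          rw [hl₂] at b₀ ⊢
          omega
        · right
          have hl₂ : x (2 * ((l.1 : ℕ) / 2) + 1) = l.2 := by
            rw [show 2 * ((l.1 : ℕ) / 2) + 1 = l.1 by omega, hxl]
          simp only [hτ]
          rw [hl₂] at b₁ ⊢
          omega
  choose w hw hw' using hgood
  refine ⟨_, _, isSolution_solution τ w ?_ ?_ ?_ fun j _ => ⟨hw j, hw' j⟩⟩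
  · simp only [numPaths]
    omega
  · simp [numPaths]
  · intro i _
    have b₀ := Bool.toNat_le (x (2 * i))
    have b₁ := Bool.toNat_le (x (2 * i + 1))
    simp only [hτ]
    omega

/-- The position of a type in the order in which the types may follow each other. -/
def rank (t : ℕ) : ℕ := if t = 0 then 0 else if t = 1 then 2 else 1

theorem rank_le (t : ℕ) : rank t ≤ 2 := by
  unfold rank
  split_ifs <;> simp

theorem Follows.rank_le {t t' : ℕ} (h : Follows t t') : rank t ≤ rank t' := by
  unfold Follows at h
  unfold rank
  split_ifs <;> omega

theorem Follows.eq_of_rank_eq {t t' : ℕ} (h : Follows t t') (hr : rank t = rank t') : t = t' := by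
  unfold Follows at h
  unfold rank at hr
  split_ifs at hr <;> omega

/-- Otherwise `f` increases strictly and exceeds `k` at `k + 1`. -/
theorem exists_eq_succ_of_monotone {k : ℕ} {f : ℕ → ℕ} (hf : ∀ r ≤ k, f r ≤ f (r + 1))
    (hk : ∀ r ≤ k + 1, f r ≤ k) : ∃ r ≤ k, f r = f (r + 1) := by
  by_contra! hcon
  have : ∀ r ≤ k + 1, r ≤ f r := by
    intro r
    induction r with
    | zero => simp
    | succ r ih =>
      intro hr
      have h₁ := ih (by omega)
      have h₂ := hf r (by omega)
      have h₃ := hcon r (by omega)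
      omega
  have h₁ := this (k + 1) le_rfl
  have h₂ := hk (k + 1) le_rfl
  omega

/-- Types that change in one direction only are constant for a whole round of columns. -/
theorem exists_constant_round {N m : ℕ} {τ : ℕ → ℕ → ℕ}
    (hτ : ∀ j, j + 1 < (2 * N + 2) * m → ∀ i < N, Follows (τ j i) (τ (j + 1) i)) (hm : 0 < m) :
    ∃ r, ∀ d < m, r * m + d < (2 * N + 2) * m ∧ ∀ i < N, τ (r * m + d) i = τ (r * m) i := by
  have mono : ∀ d j, j + d < (2 * N + 2) * m → ∀ i < N, rank (τ j i) ≤ rank (τ (j + d) i) := by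
    intro d
    induction d with
    | zero => simp
    | succ d ih =>
      intro j hj i hi
      exact (ih j (by omega) i hi).trans (hτ (j + d) hj i hi).rank_le
  have hlt : ∀ r ≤ 2 * N, r * m + m < (2 * N + 2) * m := fun r hr => by nlinarith
  have hsucc : ∀ r, (r + 1) * m = r * m + m := fun r => by ring
  -- The total rank of a column is at most `2 N`, and it is compared at the starts of the `2 N + 2`
  -- rounds.
  obtain ⟨r, hr, heq⟩ := exists_eq_succ_of_monotone (k := 2 * N)
    (f := fun r => ∑ i ∈ Finset.range N, rank (τ (r * m) i))
    (fun r hr => Finset.sum_le_sum fun i hi => by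
      rw [hsucc]
      exact mono m (r * m) (hlt r hr) i (Finset.mem_range.1 hi))
    (fun r _ => (Finset.sum_le_card_nsmul _ _ 2 fun i _ => rank_le _).trans (by simp [mul_comm]))
  have heq' : ∀ i < N, rank (τ (r * m) i) = rank (τ (r * m + m) i) := by
    rw [hsucc] at heq
    intro i hi
    exact (Finset.sum_eq_sum_iff_of_le fun i hi => mono m (r * m) (hlt r hr) i
      (Finset.mem_range.1 hi)).1 heq i (Finset.mem_range.2 hi)
  refine ⟨r, fun d hd => ?_⟩
  have hr' := hlt r hr
  refine ⟨by omega, fun i hi => ?_⟩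
  induction d with
  | zero => simp
  | succ d ih =>
    rw [← ih (by omega)]
    -- Ranks inside the round are squeezed between equal values, and a type that may follow another
    -- with the same rank is equal to it.
    have h₁ := mono d (r * m) (by omega) i hi
    have h₂ := mono (m - (d + 1)) (r * m + (d + 1)) (by omega) i hi
    rw [show r * m + (d + 1) + (m - (d + 1)) = r * m + m by omega, ← heq' i hi] at h₂
    have h₃ := hτ (r * m + d) (by omega) i hi
    exact (h₃.eq_of_rank_eq (le_antisymm h₃.rank_le (h₂.trans h₁))).symm

/-- A round without changes contains a column for every clause, and the bits of its types are the
assignment. -/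
theorem satisfiable_of_isSolution {φ : CNFFormula} {S : Finset (ℕ × ℕ)} {c : ℕ × ℕ → Bool}
    (h : IsSolution (numPaths φ.numVars) (numPaths φ.numVars * numColumns φ) (Good φ) S c) :
    φ.Satisfiable := by
  obtain ⟨τ, hlt, hτ, hgood⟩ := h.exists_types (by simp only [numPaths]; omega)
    (by simp [numPaths]) (Nat.mul_pos (by omega) (by omega))
  obtain ⟨r, hr⟩ := exists_constant_round (m := φ.clauses.length + 1) hτ (by omega)
  set m := φ.clauses.length + 1 with hm
  refine ⟨fun x => if (x : ℕ) % 2 = 0 then τ (r * m) (x / 2) % 2 = 1 else τ (r * m) (x / 2) / 2 = 1,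
    fun cl hcl => ?_⟩
  obtain ⟨d, hd, rfl⟩ := List.getElem_of_mem hcl
  obtain ⟨hj, hconst⟩ := hr d (by omega)
  obtain ⟨i, hi, hg⟩ := hgood _ hj
  have h4 := hlt _ hj i hi
  rw [hconst i hi] at hg h4
  obtain ⟨l, hl, hlv⟩ := hg φ.clauses[d] (by
    rw [← hm, Nat.mul_add_mod', Nat.mod_eq_of_lt (by omega), List.getElem?_eq_getElem])
  refine ⟨l, hl, ?_⟩
  have hb := Bool.toNat_le l.2
  have key : ∀ (P : Prop) [Decidable P] (b : Bool), (P ↔ b.toNat = 1) → decide P = b := by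
    intro P _ b hP
    cases b <;> simp_all
  rcases hlv with hlv | hlv
  · have h₁ : (l.1 : ℕ) / 2 = i := by omega
    have h₂ : (l.1 : ℕ) % 2 = 0 := by omega
    simp only [h₁, h₂, if_true]
    exact key _ _ (by omega)
  · have h₁ : (l.1 : ℕ) / 2 = i := by omega
    have h₂ : (l.1 : ℕ) % 2 ≠ 0 := by omega
    simp only [h₁, h₂, if_false]
    exact key _ _ (by omega)

/-- The instance of Connected Odd Cycle Transversal for a formula. -/
def reduction (φ : CNFFormula) : GraphWithBudget :=
  gridInstance (numPaths φ.numVars) (numPaths φ.numVars * numColumns φ) (Good φ)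

theorem hasConnectedOCT_reduction (φ : CNFFormula) :
    (reduction φ).HasConnectedOCT ↔ φ.Satisfiable :=
  (exists_isConnectedOCT_iff
    (Nat.mul_pos (by simp [numPaths]) (Nat.mul_pos (by omega) (by omega)))).trans
    ⟨fun ⟨_, _, h⟩ => satisfiable_of_isSolution h, exists_isSolution_of_satisfiable⟩

end CycleTransversal

/-! ### Cutwidth of the natural order, and the encoding of the instance. -/

namespace CycleTransversal

/-- A superset of the pairs of vertices that are joined across a cut inside segment `r`. -/
def cutPairs (N r : ℕ) : Finset (ℕ × ℕ) :=
  Finset.Ico ((r - 1) * 90) ((r + 2) * 90) ×ˢ Finset.Ico ((r - 1) * 90) ((r + 2) * 90) ∪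
  ({(N * (r / N) * 90 + 10, (N * (r / N) + N - 1) * 90 + 10)} ∪
  (Finset.range (N + 1)).image fun d => ((r - d) * 90 + 5, (r - d + N) * 90 + 4))

/-- Three neighbouring segments give at most `270 ^ 2 = 72900` pairs, the closing edge of the column
one, and the path edges `N + 1`. -/
theorem card_cutPairs_le (N r : ℕ) : (cutPairs N r).card ≤ N + 72902 := by
  rw [cutPairs]
  refine (Finset.card_union_le _ _).trans ?_
  have h₁ : ((r + 2) * 90 - (r - 1) * 90) * ((r + 2) * 90 - (r - 1) * 90) ≤ 270 * 270 :=
    Nat.mul_le_mul (by omega) (by omega)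
  have h₂ := Finset.card_union_le
    ({(N * (r / N) * 90 + 10, (N * (r / N) + N - 1) * 90 + 10)} : Finset (ℕ × ℕ))
    ((Finset.range (N + 1)).image fun d => ((r - d) * 90 + 5, (r - d + N) * 90 + 4))
  have h₃ := Finset.card_image_le (s := Finset.range (N + 1))
    (f := fun d : ℕ => ((r - d) * 90 + 5, (r - d + N) * 90 + 4))
  simp only [Finset.card_range, Finset.card_singleton, Finset.card_product, Nat.card_Ico]
    at h₂ h₃ ⊢
  omega

theorem near_mem_cutPairs {N r j k : ℕ} (hj : j / 90 ≤ r + 1) (hj' : r ≤ j / 90 + 1)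
    (hk : k / 90 ≤ r + 1) (hk' : r ≤ k / 90 + 1) : (j, k) ∈ cutPairs N r := by
  rw [cutPairs, Finset.mem_union, Finset.mem_product, Finset.mem_Ico, Finset.mem_Ico]
  left
  simp only
  omega

/-- Links stay within a segment or go to the next one, except for the closing edge of a column and
the path edges, which span `N - 1` and `N` segments. -/
theorem mem_cutPairs {N M : ℕ} {good : ℕ → ℕ → ℕ → Prop} (hN : 3 ≤ N) {i j k : ℕ} (hji : j ≤ i)
    (hik : i < k) (hadj : (grid N M good).Adj (j / 90, j % 90) (k / 90, k % 90)) :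
    (j, k) ∈ cutPairs N (i / 90) := by
  have hj : j / 90 ≤ i / 90 := Nat.div_le_div_right hji
  have hk : i / 90 ≤ k / 90 := Nat.div_le_div_right hik.le
  rcases ((SimpleGraph.fromRel_adj _ _ _).1 hadj).2 with hl | hl
  · simp only [Link] at hl
    rcases hl with hl | hl | hl | hl | hl | hl | ⟨h₁, h₂, h₃, h₄⟩ | ⟨h₁, h₂, h₃⟩
    iterate 6 exact near_mem_cutPairs (by omega) (by omega) (by omega) (by omega)
    · rw [cutPairs, Finset.mem_union, Finset.mem_union, Finset.mem_singleton]
      right; left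
      have hdiv : i / 90 / N = j / 90 / N := by
        have h₅ := Nat.div_add_mod (j / 90) N
        refine Nat.div_eq_of_lt_le ?_ ?_
        · rw [mul_comm]
          omega
        · rw [add_mul, mul_comm]
          omega
      have h₅ := Nat.div_add_mod (j / 90) N
      rw [hdiv]
      rw [h₂, add_zero] at h₅
      ext
      · simp only
        omega
      · simp only
        omega
    · rw [cutPairs, Finset.mem_union, Finset.mem_union, Finset.mem_image]
      refine Or.inr (Or.inr ⟨i / 90 - j / 90, Finset.mem_range.2 (by omega), ?_⟩)
      ext
      · simp only
        omega
      · simp only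
        omega
  · simp only [Link] at hl
    rcases hl with hl | hl | hl | hl | hl | hl | hl | hl
    all_goals exact near_mem_cutPairs (by omega) (by omega) (by omega) (by omega)

theorem arrangementWidth_le {N M : ℕ} (good : ℕ → ℕ → ℕ → Prop) (hN : 3 ≤ N) :
    ((grid N M good).comap (position M)).arrangementWidth (Equiv.refl (Fin (M * 90))) ≤
      N + 72902 := by
  refine Finset.sup_le fun i _ => ?_
  have hsub : ((grid N M good).comap (position M)).arrangementCut (Equiv.refl _) i ⊆
      (fun p : Fin (M * 90) × Fin (M * 90) => s(p.1, p.2)) ''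
        {p | ((p.1 : ℕ), (p.2 : ℕ)) ∈ cutPairs N ((i : ℕ) / 90)} := by
    rintro e ⟨he, j, k, hj, hk, rfl⟩
    exact ⟨(j, k), mem_cutPairs hN hj hk he, rfl⟩
  refine (Set.ncard_le_ncard hsub (Set.toFinite _)).trans
    ((Set.ncard_image_le (Set.toFinite _)).trans ?_)
  rw [← Set.ncard_image_of_injective (f := fun p : Fin (M * 90) × Fin (M * 90) =>
    ((p.1 : ℕ), (p.2 : ℕ)))]
  · refine le_trans (Set.ncard_le_ncard (t := (cutPairs N ((i : ℕ) / 90) : Set (ℕ × ℕ))) ?_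
      (Finset.finite_toSet _)) ?_
    · rintro _ ⟨p, hp, rfl⟩
      exact hp
    · rw [Set.ncard_coe_finset]
      exact card_cutPairs_le _ _
  · rintro ⟨a, b⟩ ⟨a', b'⟩ h
    simp only [Prod.mk.injEq] at h
    exact Prod.ext (Fin.ext h.1) (Fin.ext h.2)

theorem flatMap_finRange {n : ℕ} (hn : 0 < n) (f : Fin n → Fin n → ℕ) :
    ((List.finRange n).flatMap fun i => (List.finRange n).map fun j => f i j) =
      List.ofFn fun x : Fin (n * n) => f ⟨(x : ℕ) / n, Nat.div_lt_of_lt_mul x.2⟩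
        ⟨(x : ℕ) % n, Nat.mod_lt _ hn⟩ := by
  rw [List.ofFn_mul, List.flatMap, List.ofFn_eq_map]
  congr 1
  refine List.map_congr_left fun i _ => ?_
  rw [List.ofFn_eq_map]
  refine List.map_congr_left fun j _ => ?_
  congr 1
  · ext
    simp only
    rw [mul_comm, Nat.mul_add_div hn, Nat.div_eq_of_lt j.2, add_zero]
  · ext
    simp only
    rw [mul_comm, Nat.mul_add_mod, Nat.mod_eq_of_lt j.2]

open Classical in
/-- The number in cell `i` of the encoding of `gridInstance`, followed by the arrangement. -/
noncomputable def outputCell (N M : ℕ) (good : ℕ → ℕ → ℕ → Prop) (i : ℕ) : ℕ :=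
  if i = 0 then M * 90 else if i = 1 then 8 * M
  else if i - 2 < M * 90 * (M * 90) then
    if (grid N M good).Adj ((i - 2) / (M * 90) / 90, (i - 2) / (M * 90) % 90)
      ((i - 2) % (M * 90) / 90, (i - 2) % (M * 90) % 90) then 1 else 0
  else i - 2 - M * 90 * (M * 90)

theorem encode_gridInstance {N M : ℕ} (good : ℕ → ℕ → ℕ → Prop) (hM : 0 < M) :
    (gridInstance N M good).encode.length = 2 + M * 90 * (M * 90) ∧
    ∀ i < 2 + M * 90 * (M * 90),
      (gridInstance N M good).encode.getD i 0 = outputCell N M good i := by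
  classical
  have h : (gridInstance N M good).encode = M * 90 :: 8 * M ::
      List.ofFn fun x : Fin (M * 90 * (M * 90)) =>
        if (grid N M good).Adj ((x : ℕ) / (M * 90) / 90, (x : ℕ) / (M * 90) % 90)
          ((x : ℕ) % (M * 90) / 90, (x : ℕ) % (M * 90) % 90) then 1 else 0 := by
    unfold GraphWithBudget.encode
    refine congrArg₂ _ rfl (congrArg₂ _ rfl ?_)
    refine (flatMap_finRange (n := M * 90) (by omega) _).trans ?_
    congr 1
  rw [h]
  refine ⟨by simp; ring, ?_⟩
  rintro (_ | _ | i) hi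
  · simp [outputCell]
  · simp [outputCell]
  · have hi' : i < M * 90 * (M * 90) := by omega
    have : ∀ l : List ℕ, (M * 90 :: 8 * M :: l).getD (i + 1 + 1) 0 = l.getD i 0 := fun l => rfl
    rw [this, List.getD_eq_getElem _ _ (by simpa using hi'), List.getElem_ofFn]
    simp only [outputCell, hi', if_true, show i + 1 + 1 - 2 = i by omega]
    simp

/-- The instance with the vertices arranged in their natural order. -/
def arrangedGridInstance (N M : ℕ) (good : ℕ → ℕ → ℕ → Prop) : ArrangedGraphWithBudget where
  toGraphWithBudget := gridInstance N M good
  arrangement := Equiv.refl _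

/-- Beyond the matrix, `outputCell` lists the natural order, so the two versions of the problem
share one cell function and differ only in the length of the output. -/
theorem encode_arrangedGridInstance {N M : ℕ} (good : ℕ → ℕ → ℕ → Prop) (hM : 0 < M) :
    (ConnectedOCTArranged.encode (arrangedGridInstance N M good)).length =
      2 + M * 90 * (M * 90) + M * 90 ∧
    ∀ i < 2 + M * 90 * (M * 90) + M * 90,
      (ConnectedOCTArranged.encode (arrangedGridInstance N M good)).getD i 0 =
        outputCell N M good i := by
  obtain ⟨hlen, hget⟩ := encode_gridInstance (N := N) good hM
  have h : ConnectedOCTArranged.encode (arrangedGridInstance N M good) =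
      (gridInstance N M good).encode ++ (List.finRange (M * 90)).map Fin.val := rfl
  rw [h]
  refine ⟨by simp [hlen], fun i hi => ?_⟩
  rcases Nat.lt_or_ge i (2 + M * 90 * (M * 90)) with hi' | hi'
  · rw [List.getD_append _ _ _ _ (by omega), hget i hi']
  · rw [List.getD_append_right _ _ _ _ (by omega), hlen,
      List.getD_eq_getElem _ _ (by simp; omega)]
    have h₁ : ¬ i - 2 < M * 90 * (M * 90) := by omega
    simp only [outputCell, h₁, if_false, show i ≠ 0 by omega, show i ≠ 1 by omega]
    simp
    omega

end CycleTransversal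

/-! ### Arithmetic and logic in terms. -/

namespace RAM.Term

variable {A B σ : ℕ → ℕ}

/-- Rename the variables of a term. -/
def rename : Term → (ℕ → ℕ) → Term
  | const c, _ => const c
  | var k, r => var (r k)
  | add e₁ e₂, r => add (e₁.rename r) (e₂.rename r)
  | sub e₁ e₂, r => sub (e₁.rename r) (e₂.rename r)
  | input e, r => input (e.rename r)
  | table e, r => table (e.rename r)
  | sum b e, r => sum (b.rename r) (e.rename (push 0 fun k => r k + 1))

theorem eval_rename (e : Term) : ∀ (r σ : ℕ → ℕ),
    (e.rename r).eval A B σ = e.eval A B fun k => σ (r k) := by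
  induction e with
  | sum b e ihb ihe =>
    intro r σ
    simp only [rename, eval, ihb, ihe]
    refine Finset.sum_congr rfl fun i _ => congrArg _ (funext fun k => ?_)
    cases k <;> rfl
  | _ => simp_all [rename, eval]

/-- The term under one more binder. -/
def lift (e : Term) : Term := e.rename Nat.succ

@[simp] theorem eval_lift (e : Term) (i : ℕ) : e.lift.eval A B (push i σ) = e.eval A B σ :=
  eval_rename _ _ _

/-- Products. -/
def mul (e₁ e₂ : Term) : Term := sum e₁ e₂.lift

/-- Negation. -/
def not (e : Term) : Term := sub (const 1) e

/-- Conjunction. -/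
def and (e₁ e₂ : Term) : Term := mul e₁ e₂

/-- Disjunction. -/
def or (e₁ e₂ : Term) : Term := not (and (not e₁) (not e₂))

/-- The test `e₁ ≤ e₂`. -/
def le (e₁ e₂ : Term) : Term := not (sub e₁ e₂)

/-- The test `e₁ < e₂`. -/
def lt (e₁ e₂ : Term) : Term := le (add e₁ (const 1)) e₂

/-- The test `e₁ = e₂`. -/
def eq (e₁ e₂ : Term) : Term := and (le e₁ e₂) (le e₂ e₁)

/-- The test whether `e` holds for a value below `b` of the variable `0`. -/
def ex (b e : Term) : Term := not (not (sum b e))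

/-- Quotients. -/
def div (e₁ e₂ : Term) : Term := sum e₁ (le (mul (add (var 0) (const 1)) e₂.lift) e₁.lift)

/-- Remainders. -/
def mod (e₁ e₂ : Term) : Term := sub e₁ (mul e₂ (div e₁ e₂))

/-- Case distinction. -/
def ite (e e₁ e₂ : Term) : Term := add (mul e e₁) (mul (not e) e₂)

/-- The test whether a pair is in a list. -/
def memPairs (e₁ e₂ : Term) : List (ℕ × ℕ) → Term
  | [] => const 0
  | p :: l => or (and (eq e₁ (const p.1)) (eq e₂ (const p.2))) (memPairs e₁ e₂ l)

@[simp] theorem eval_const (c : ℕ) : (const c).eval A B σ = c := by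
  simp only [eval]

@[simp] theorem eval_var (k : ℕ) : (var k).eval A B σ = σ k := by
  simp only [eval]

@[simp] theorem eval_add (e₁ e₂ : Term) :
    (add e₁ e₂).eval A B σ = e₁.eval A B σ + e₂.eval A B σ := by
  simp only [eval]

@[simp] theorem eval_sub (e₁ e₂ : Term) :
    (sub e₁ e₂).eval A B σ = e₁.eval A B σ - e₂.eval A B σ := by
  simp only [eval]

@[simp] theorem eval_input (e : Term) : (input e).eval A B σ = A (e.eval A B σ) := by
  simp only [eval]

@[simp] theorem eval_table (e : Term) : (table e).eval A B σ = B (e.eval A B σ) := by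
  simp only [eval]

@[simp] theorem eval_mul (e₁ e₂ : Term) :
    (mul e₁ e₂).eval A B σ = e₁.eval A B σ * e₂.eval A B σ := by
  simp [mul, eval]

/-- The value of `e` is the truth value of `P`. -/
def Decides (A B σ : ℕ → ℕ) (e : Term) (P : Prop) : Prop :=
  (e.eval A B σ = 1 ∧ P) ∨ (e.eval A B σ = 0 ∧ ¬ P)

theorem Decides.of_iff {e : Term} {P Q : Prop} (h : Decides A B σ e P) (hPQ : P ↔ Q) :
    Decides A B σ e Q := by
  rwa [Decides, ← hPQ]

theorem Decides.not {e : Term} {P : Prop} (h : Decides A B σ e P) :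
    Decides A B σ e.not (¬ P) := by
  rcases h with ⟨h, hP⟩ | ⟨h, hP⟩
  · exact Or.inr ⟨by simp [Term.not, h], not_not.2 hP⟩
  · exact Or.inl ⟨by simp [Term.not, h], hP⟩

theorem Decides.and {e₁ e₂ : Term} {P Q : Prop} (h₁ : Decides A B σ e₁ P)
    (h₂ : Decides A B σ e₂ Q) : Decides A B σ (e₁.and e₂) (P ∧ Q) := by
  rcases h₁ with ⟨h₁, hP⟩ | ⟨h₁, hP⟩ <;> rcases h₂ with ⟨h₂, hQ⟩ | ⟨h₂, hQ⟩ <;>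
    simp [Decides, Term.and, h₁, h₂, hP, hQ]

theorem Decides.or {e₁ e₂ : Term} {P Q : Prop} (h₁ : Decides A B σ e₁ P)
    (h₂ : Decides A B σ e₂ Q) : Decides A B σ (e₁.or e₂) (P ∨ Q) :=
  (h₁.not.and h₂.not).not.of_iff (by tauto)

theorem decides_le (e₁ e₂ : Term) :
    Decides A B σ (e₁.le e₂) (e₁.eval A B σ ≤ e₂.eval A B σ) := by
  simp only [Decides, le, not, eval_sub, eval_const]
  omega

theorem decides_lt (e₁ e₂ : Term) :
    Decides A B σ (e₁.lt e₂) (e₁.eval A B σ < e₂.eval A B σ) := decides_le _ _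

theorem decides_eq (e₁ e₂ : Term) :
    Decides A B σ (e₁.eq e₂) (e₁.eval A B σ = e₂.eval A B σ) :=
  ((decides_le _ _).and (decides_le _ _)).of_iff (by omega)

theorem Decides.ex {b e : Term} {P : ℕ → Prop} (h : ∀ i, Decides A B (push i σ) e (P i)) :
    Decides A B σ (b.ex e) (∃ i < b.eval A B σ, P i) := by
  have hiff : (b.sum e).eval A B σ = 0 ↔ ¬ ∃ i < b.eval A B σ, P i := by
    simp only [eval, Finset.sum_eq_zero_iff, Finset.mem_range, not_exists, not_and]
    refine forall₂_congr fun i _ => ?_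
    rcases h i with ⟨h, hP⟩ | ⟨h, hP⟩ <;> simp [h, hP]
  by_cases h0 : (b.sum e).eval A B σ = 0
  · exact Or.inr ⟨by simp [Term.ex, Term.not, h0], hiff.1 h0⟩
  · refine Or.inl ⟨?_, not_not.1 fun hn => h0 (hiff.2 hn)⟩
    simp only [Term.ex, Term.not, eval_sub, eval_const]
    omega

theorem decides_memPairs (e₁ e₂ : Term) (l : List (ℕ × ℕ)) :
    Decides A B σ (memPairs e₁ e₂ l) ((e₁.eval A B σ, e₂.eval A B σ) ∈ l) := by
  induction l with
  | nil => simp [Decides, memPairs]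
  | cons p l ih =>
    refine (((decides_eq _ _).and (decides_eq _ _)).or ih).of_iff ?_
    simp [Prod.ext_iff]

/-- The quotient of `x` by `y` counts the `i < x` with `(i + 1) * y ≤ x`. -/
theorem eval_div (e₁ e₂ : Term) (h : 0 < e₂.eval A B σ) :
    (div e₁ e₂).eval A B σ = e₁.eval A B σ / e₂.eval A B σ := by
  set x := e₁.eval A B σ with hx
  set y := e₂.eval A B σ with hy
  have hle : ∀ i, (le (mul (add (var 0) (const 1)) e₂.lift) e₁.lift).eval A B (push i σ) =
      if i < x / y then 1 else 0 := by
    intro i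
    have := decides_le (A := A) (B := B) (σ := push i σ)
      (mul (add (var 0) (const 1)) e₂.lift) e₁.lift
    simp only [eval_mul, eval_add, eval_var, push_zero, eval_const, eval_lift, ← hx, ← hy,
      ← Nat.le_div_iff_mul_le h, Decides, Nat.succ_le_iff] at this
    split_ifs <;> omega
  simp only [div, eval, hle, ← hx]
  rw [← Finset.sum_filter, Finset.sum_const, smul_eq_mul, mul_one]
  have : (Finset.range x).filter (· < x / y) = Finset.range (x / y) := by
    ext i
    have := Nat.div_le_self x y
    simp only [Finset.mem_filter, Finset.mem_range]
    omega
  rw [this, Finset.card_range]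

theorem eval_mod (e₁ e₂ : Term) (h : 0 < e₂.eval A B σ) :
    (mod e₁ e₂).eval A B σ = e₁.eval A B σ % e₂.eval A B σ := by
  rw [mod, eval_sub, eval_mul, eval_div _ _ h]
  have := Nat.div_add_mod (e₁.eval A B σ) (e₂.eval A B σ)
  omega

open Classical in
theorem Decides.eval_ite {e e₁ e₂ : Term} {P : Prop} (h : Decides A B σ e P) :
    (Term.ite e e₁ e₂).eval A B σ = if P then e₁.eval A B σ else e₂.eval A B σ := by
  rcases h with ⟨h, hP⟩ | ⟨h, hP⟩ <;> simp [Term.ite, Term.not, h, hP]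

open Classical in
theorem Decides.eval_eq {e : Term} {P : Prop} (h : Decides A B σ e P) :
    e.eval A B σ = if P then 1 else 0 := by
  rcases h with ⟨h, hP⟩ | ⟨h, hP⟩ <;> simp [h, hP]

end RAM.Term

/-! ### Reading a formula from its encoding. -/

namespace CNFFormula

open RAM

/-- The clauses of a formula as lists of numbers. -/
def blocks (φ : CNFFormula) : List (List ℕ) :=
  φ.clauses.map fun c => c.map fun l => 2 * (l.1 : ℕ) + l.2.toNat

/-- The encoding of a formula as an array. -/
def array (φ : CNFFormula) : ℕ → ℕ := fun i => φ.encode.getD i 0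

/-- The positions of the clauses in the encoding. -/
def positions (φ : CNFFormula) : ℕ → ℕ := blockTable φ.array (φ.encode.getD 1 0)

theorem array_zero (φ : CNFFormula) : φ.array 0 = φ.numVars := rfl

theorem array_one (φ : CNFFormula) : φ.array 1 = φ.clauses.length := rfl

/-- Cutting the encoding at block `c` leaves the blocks from `c` on, so the cell read next is the
length of that block. -/
theorem drop_blockStart (φ : CNFFormula) (c : ℕ) (hc : c ≤ φ.clauses.length) :
    blockStart φ.array c ≤ φ.encode.length ∧
    φ.encode.drop (blockStart φ.array c) =
      (φ.blocks.drop c).flatMap fun b => b.length :: b := by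
  induction c with
  | zero => simp [blockStart, encode, blocks, List.flatMap_map]
  | succ c ih =>
    obtain ⟨hle, hdrop⟩ := ih (by omega)
    have hlt : c < φ.blocks.length := by simpa [blocks] using hc
    rw [List.drop_eq_getElem_cons hlt, List.flatMap_cons] at hdrop
    have hA : φ.array (blockStart φ.array c) = φ.blocks[c].length := by
      have := congrArg (fun l => l.getD 0 0) hdrop
      simpa [array, List.getD_eq_getElem?_getD] using this
    have hlen := congrArg List.length hdrop
    simp only [List.length_drop, List.length_append, List.length_cons] at hlen
    refine ⟨by simp only [blockStart, hA]; omega, ?_⟩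
    simp only [blockStart, hA]
    rw [add_assoc, ← List.drop_drop, hdrop, List.drop_left' (by simp; omega)]

theorem positions_le (φ : CNFFormula) (c : ℕ) : φ.positions c ≤ φ.encode.length := by
  unfold positions blockTable
  split_ifs with h
  · exact (φ.drop_blockStart c h).1
  · omega

theorem array_positions (φ : CNFFormula) {c : ℕ} (hc : c < φ.clauses.length) :
    φ.array (φ.positions c) = φ.clauses[c].length ∧
    ∀ k, (hk : k < φ.clauses[c].length) → φ.array (φ.positions c + 1 + k) =
      2 * (φ.clauses[c][k].1 : ℕ) + φ.clauses[c][k].2.toNat := by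
  have hpos : φ.positions c = blockStart φ.array c := by
    rw [positions, blockTable, if_pos]
    exact hc.le
  obtain ⟨-, hdrop⟩ := φ.drop_blockStart c hc.le
  have hlt : c < φ.blocks.length := by simpa [blocks] using hc
  rw [List.drop_eq_getElem_cons hlt, List.flatMap_cons, ← hpos] at hdrop
  have key : ∀ d, φ.array (φ.positions c + d) = ((φ.blocks[c].length :: φ.blocks[c]) ++
      List.flatMap (fun b => b.length :: b) (List.drop (c + 1) φ.blocks)).getD d 0 := by
    intro d
    rw [← hdrop]
    simp [array, List.getD_eq_getElem?_getD]
  refine ⟨?_, fun k hk => ?_⟩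
  · have := key 0
    simpa [blocks] using this
  · have := key (k + 1)
    rw [show φ.positions c + (k + 1) = φ.positions c + 1 + k by ring] at this
    rw [this]
    have hk' : k < φ.blocks[c].length := by simpa [blocks] using hk
    rw [List.cons_append, List.getD_cons_succ, List.getD_append _ _ _ _ hk',
      List.getD_eq_getElem _ _ hk']
    simp [blocks]

end CNFFormula

/-! ### The reduction as a term. -/

namespace CycleTransversal

open RAM Term

/-- The number of paths as a term. -/
def pathsTerm : Term := add (mul (const 2) (div (input (const 0)) (const 4))) (const 3)

/-- The number of clauses plus one as a term. -/
def roundTerm : Term := add (input (const 1)) (const 1)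

/-- The number of segments as a term. -/
def segmentsTerm : Term :=
  mul pathsTerm (mul (add (mul (const 2) pathsTerm) (const 2)) roundTerm)

/-- The number of vertices as a term. -/
def verticesTerm : Term := mul segmentsTerm (const 90)

/-- The test `Good` as a term. -/
def goodTerm (j i t : Term) : Term :=
  not (and (lt (mod j roundTerm) (input (const 1)))
    (not (ex (input (table (mod j roundTerm)))
      (or
        (eq (input (add (add (table (mod j roundTerm)).lift (const 1)) (var 0)))
          (add (mul (const 4) i.lift) (mod t.lift (const 2))))
        (eq (input (add (add (table (mod j roundTerm)).lift (const 1)) (var 0)))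
          (add (add (mul (const 4) i.lift) (const 2)) (div t.lift (const 2))))))))

/-- The test `Link` as a term. -/
def linkTerm (s a s' b : Term) : Term :=
  or (and (eq s' s) (memPairs a b innerEdges))
  (or (and (eq s' s) (and (lt a (const 4)) (and
    (not (goodTerm (div s pathsTerm) (mod s pathsTerm) a))
    (eq b (add (const 78) (mul (const 3) a))))))
  (or (and (eq s' s) (and (lt s pathsTerm) (and (eq a (const 4)) (eq b (const 12)))))
  (or (and (eq s' s) (and (le segmentsTerm (add s pathsTerm))
    (and (eq a (const 5)) (eq b (const 12)))))
  (or (and (eq s' (add s (const 1))) (and (or (eq a (const 12)) (eq a (const 16))) (eq b a)))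
  (or (and (eq s' (add s (const 1))) (and (not (eq (mod s' pathsTerm) (const 0)))
    (and (eq a (const 10)) (eq b (const 10)))))
  (or (and (eq (add s' (const 1)) (add s pathsTerm)) (and (eq (mod s pathsTerm) (const 0))
    (and (eq a (const 10)) (eq b (const 10)))))
  (and (eq s' (add s pathsTerm)) (and (eq a (const 5)) (eq b (const 4))))))))))

/-- Adjacency in the grid as a term. -/
def adjTerm (s a s' b : Term) : Term :=
  and (not (and (eq s s') (eq a b))) (or (linkTerm s a s' b) (linkTerm s' b s a))

/-- A cell of the encoding of the reduction as a term. -/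
def cellTerm : Term :=
  ite (eq (var 0) (const 0)) verticesTerm
  (ite (eq (var 0) (const 1)) (mul (const 8) segmentsTerm)
  (ite (lt (sub (var 0) (const 2)) (mul verticesTerm verticesTerm))
    (adjTerm (div (div (sub (var 0) (const 2)) verticesTerm) (const 90))
      (mod (div (sub (var 0) (const 2)) verticesTerm) (const 90))
      (div (mod (sub (var 0) (const 2)) verticesTerm) (const 90))
      (mod (mod (sub (var 0) (const 2)) verticesTerm) (const 90)))
    (sub (sub (var 0) (const 2)) (mul verticesTerm verticesTerm))))

/-- The length of the encoding of a graph as a term. -/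
def lengthTerm : Term := add (const 2) (mul verticesTerm verticesTerm)

/-- The length of the encoding of an arranged graph as a term. -/
def arrangedLengthTerm : Term := add lengthTerm verticesTerm

variable (φ : CNFFormula) (σ : ℕ → ℕ)

/-- The number of segments of the reduction. -/
def numSegments : ℕ := numPaths φ.numVars * numColumns φ

theorem numPaths_pos (n : ℕ) : 0 < numPaths n := by simp [numPaths]

theorem numSegments_pos : 0 < numSegments φ :=
  Nat.mul_pos (numPaths_pos _) (Nat.mul_pos (by omega) (by omega))

theorem eval_pathsTerm : pathsTerm.eval φ.array φ.positions σ = numPaths φ.numVars := by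
  simp [pathsTerm, eval_div, numPaths, φ.array_zero]

theorem eval_roundTerm : roundTerm.eval φ.array φ.positions σ = φ.clauses.length + 1 := by
  simp [roundTerm, φ.array_one]

theorem eval_segmentsTerm : segmentsTerm.eval φ.array φ.positions σ = numSegments φ := by
  simp [segmentsTerm, eval_pathsTerm, eval_roundTerm, numSegments, numColumns]

theorem eval_verticesTerm : verticesTerm.eval φ.array φ.positions σ = numSegments φ * 90 := by
  simp [verticesTerm, eval_segmentsTerm]

/-- The literal is found by a bounded search through the block of the clause; the test on the index
accounts for the trivial column at the end of each round. -/
theorem decides_goodTerm (j i t : Term) : Decides φ.array φ.positions σ (goodTerm j i t)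
    (Good φ (j.eval φ.array φ.positions σ) (i.eval φ.array φ.positions σ)
      (t.eval φ.array φ.positions σ)) := by
  have hround : 0 < roundTerm.eval φ.array φ.positions σ := by
    rw [eval_roundTerm]
    omega
  refine ((decides_lt _ _).and (Decides.ex fun k =>
    (decides_eq _ _).or (decides_eq _ _)).not).not.of_iff ?_
  simp only [eval_mod _ _ hround, eval_roundTerm, eval_input, eval_const, φ.array_one, eval_table,
    eval_add, eval_lift, eval_mul, eval_var, push_zero,
    eval_mod (A := φ.array) (B := φ.positions) _ (const 2) (by simp),
    eval_div (A := φ.array) (B := φ.positions) _ (const 2) (by simp)]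
  simp only [Good]
  generalize j.eval φ.array φ.positions σ % (φ.clauses.length + 1) = d
  rw [not_and]
  by_cases hd : d < φ.clauses.length
  · obtain ⟨hlen, hget⟩ := φ.array_positions hd
    simp only [hd, forall_const, not_not, hlen, List.getElem?_eq_getElem, Option.some.injEq,
      forall_eq']
    constructor
    · rintro ⟨k, hk, h⟩
      rw [hget k hk] at h
      exact ⟨_, List.getElem_mem hk, h⟩
    · rintro ⟨l, hl, h⟩
      obtain ⟨k, hk, rfl⟩ := List.getElem_of_mem hl
      exact ⟨k, hk, by rwa [hget k hk]⟩
  · simp [hd]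

theorem decides_linkTerm (s a s' b : Term) : Decides φ.array φ.positions σ (linkTerm s a s' b)
    (Link (numPaths φ.numVars) (numSegments φ) (Good φ) (s.eval φ.array φ.positions σ)
      (a.eval φ.array φ.positions σ) (s'.eval φ.array φ.positions σ)
      (b.eval φ.array φ.positions σ)) := by
  have hpaths : 0 < pathsTerm.eval φ.array φ.positions σ := by
    rw [eval_pathsTerm]
    exact numPaths_pos _
  unfold linkTerm Link
  refine ((decides_eq _ _).and (decides_memPairs _ _ _)).or ?_
  refine ((decides_eq _ _).and ((decides_lt _ _).and
    (((decides_goodTerm φ σ _ _ _).not.and (decides_eq _ _)).of_iff ?_))).or ?_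
  · simp [eval_div _ _ hpaths, eval_mod _ _ hpaths, eval_pathsTerm]
  refine ((decides_eq _ _).and (((decides_lt _ _).of_iff ?_).and
    ((decides_eq _ _).and (decides_eq _ _)))).or ?_
  · rw [eval_pathsTerm]
  refine ((decides_eq _ _).and (((decides_le _ _).of_iff ?_).and
    ((decides_eq _ _).and (decides_eq _ _)))).or ?_
  · rw [eval_add, eval_pathsTerm, eval_segmentsTerm]
  refine ((decides_eq _ _).and (((decides_eq _ _).or (decides_eq _ _)).and
    (decides_eq _ _))).or ?_
  refine ((decides_eq _ _).and (((decides_eq _ _).not.of_iff ?_).and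
    ((decides_eq _ _).and (decides_eq _ _)))).or ?_
  · rw [eval_mod _ _ hpaths, eval_pathsTerm, eval_const]
  refine (((decides_eq _ _).of_iff ?_).and (((decides_eq _ _).of_iff ?_).and
    ((decides_eq _ _).and (decides_eq _ _)))).or ?_
  · rw [eval_add, eval_add, eval_pathsTerm, eval_const]
  · rw [eval_mod _ _ hpaths, eval_pathsTerm, eval_const]
  refine ((decides_eq _ _).of_iff ?_).and ((decides_eq _ _).and (decides_eq _ _))
  rw [eval_add, eval_pathsTerm]

theorem decides_adjTerm (s a s' b : Term) : Decides φ.array φ.positions σ (adjTerm s a s' b)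
    ((grid (numPaths φ.numVars) (numSegments φ) (Good φ)).Adj
      (s.eval φ.array φ.positions σ, a.eval φ.array φ.positions σ)
      (s'.eval φ.array φ.positions σ, b.eval φ.array φ.positions σ)) := by
  refine (((decides_eq _ _).and (decides_eq _ _)).not.and
    ((decides_linkTerm φ σ _ _ _ _).or (decides_linkTerm φ σ _ _ _ _))).of_iff ?_
  rw [grid, SimpleGraph.fromRel_adj, ne_eq, Prod.mk.injEq]

theorem eval_cellTerm (i : ℕ) : cellTerm.eval φ.array φ.positions (fun _ => i) =
    outputCell (numPaths φ.numVars) (numSegments φ) (Good φ) i := by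
  have hV : 0 < verticesTerm.eval φ.array φ.positions fun _ => i := by
    rw [eval_verticesTerm]
    have := numSegments_pos φ
    omega
  have hdiv : ∀ e, (div e (const 90)).eval φ.array φ.positions (fun _ => i) =
      e.eval φ.array φ.positions (fun _ => i) / 90 := fun e => by simp [eval_div]
  have hmod : ∀ e, (mod e (const 90)).eval φ.array φ.positions (fun _ => i) =
      e.eval φ.array φ.positions (fun _ => i) % 90 := fun e => by simp [eval_mod]
  rw [cellTerm, (decides_eq _ _).eval_ite, (decides_eq _ _).eval_ite, (decides_lt _ _).eval_ite,
    (decides_adjTerm φ _ _ _ _ _).eval_eq, outputCell, hdiv, hmod, hdiv, hmod,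
    eval_div _ _ hV, eval_mod _ _ hV, eval_verticesTerm, eval_sub, eval_var, eval_const 2]
  simp only [eval_verticesTerm, eval_segmentsTerm, eval_mul, eval_sub, eval_var, eval_const]

theorem eval_lengthTerm : lengthTerm.eval φ.array φ.positions σ =
    2 + numSegments φ * 90 * (numSegments φ * 90) := by
  simp [lengthTerm, eval_verticesTerm]

theorem eval_arrangedLengthTerm : arrangedLengthTerm.eval φ.array φ.positions σ =
    2 + numSegments φ * 90 * (numSegments φ * 90) + numSegments φ * 90 := by
  simp [arrangedLengthTerm, eval_lengthTerm, eval_verticesTerm]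

end CycleTransversal

/-! ### Running time, and the transfer to satisfiability. -/

namespace RAM

theorem Runs.one_le {p : Program} {s s' : State} {t : ℕ} (h : Runs p s s' t) : 1 ≤ t := by
  induction h <;> omega

theorem exists_overhead_bound (len e : Term) : ∃ c : ℕ, ∀ X ≥ 2, ∀ w : List ℕ,
    (∀ i, w.getD i 0 ≤ X) → (∀ i, blockTable (fun i => w.getD i 0) (w.getD 1 0) i ≤ X) →
    overhead len e w ≤ X ^ c ∧
    len.eval (fun i => w.getD i 0) (blockTable (fun i => w.getD i 0) (w.getD 1 0)) (fun _ => 0) ≤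
      X ^ c ∧
    ∀ i < len.eval (fun i => w.getD i 0) (blockTable (fun i => w.getD i 0) (w.getD 1 0))
      (fun _ => 0), e.eval (fun i => w.getD i 0) (blockTable (fun i => w.getD i 0) (w.getD 1 0))
        (fun _ => i) ≤ X ^ c := by
  obtain ⟨c₁, h₁⟩ := len.exists_pow_bound
  obtain ⟨c₂, h₂⟩ := e.exists_pow_bound
  refine ⟨4 + c₁ + (c₁ + 1) * c₂, fun X hX w hA hB => ?_⟩
  unfold overhead
  set A := fun i => w.getD i 0 with hAdef
  set B := blockTable A (w.getD 1 0) with hBdef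
  have k₁ := h₁ X hX A B (fun _ => 0) hA hB fun _ => by omega
  have hXY : X ≤ X ^ (c₁ + 1) := Nat.le_self_pow (by omega) X
  have k₂ : ∀ i ∈ Finset.range (len.eval A B fun _ => 0),
      e.eval A B (fun _ => i) ≤ (X ^ (c₁ + 1)) ^ c₂ ∧
      e.cost A B (fun _ => i) ≤ (X ^ (c₁ + 1)) ^ c₂ := by
    intro i hi
    exact h₂ _ (hX.trans hXY) A B _ (fun i => (hA i).trans hXY) (fun i => (hB i).trans hXY)
      fun _ => ((Finset.mem_range.1 hi).le.trans k₁.1).trans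
        (Nat.pow_le_pow_right (by omega) (by omega))
  have e₂ := Finset.sum_le_card_nsmul _ _ _ fun i hi => Nat.add_le_add_right (k₂ i hi).2 3
  simp only [Finset.card_range, smul_eq_mul] at e₂
  have p₁ : 1 ≤ X ^ c₁ := Nat.one_le_pow _ _ (by omega)
  have p₂ : 1 ≤ (X ^ (c₁ + 1)) ^ c₂ := Nat.one_le_pow _ _ (by positivity)
  have p₃ : 2 ^ 3 ≤ X ^ 3 := Nat.pow_le_pow_left hX 3
  have hexp : X ^ (4 + c₁ + (c₁ + 1) * c₂) = X ^ 3 * X * (X ^ c₁ * (X ^ (c₁ + 1)) ^ c₂) := by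
    rw [← pow_mul, pow_add, pow_add]
    ring
  rw [hexp]
  have hA1 := hA 1
  generalize (X ^ (c₁ + 1)) ^ c₂ = b at *
  generalize X ^ c₁ = a at *
  have ha : a ≤ a * b := Nat.le_mul_of_pos_right _ p₂
  have hb : b ≤ a * b := Nat.le_mul_of_pos_left _ p₁
  have q₁ : 8 * X * (a * b) ≤ X ^ 3 * X * (a * b) :=
    Nat.mul_le_mul_right _ (Nat.mul_le_mul_right _ (by simpa using p₃))
  have q₂ : 8 * 2 * (a * b) ≤ 8 * X * (a * b) := Nat.mul_le_mul_right _ (by omega)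
  have m₂ : (len.eval A B fun _ => 0) * (b + 3) ≤ a * (b + 3) := Nat.mul_le_mul_right _ k₁.1
  have m₃ : a * (b + 3) = a * b + 3 * a := by ring
  have q₃ : 8 * X ≤ 8 * X * (a * b) := Nat.le_mul_of_pos_right _ (Nat.mul_pos p₁ p₂)
  have k₁' := k₁.1
  have k₁'' := k₁.2
  refine ⟨?_, by omega, fun i hi => ?_⟩
  · nlinarith
  · have := (k₂ i (Finset.mem_range.2 hi)).1
    omega

end RAM

theorem List.sum_map_size_le (l : List ℕ) (b : ℕ) (h : ∀ i < l.length, l.getD i 0 ≤ b) :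
    (l.map fun a => Nat.size a + 1).sum ≤ l.length * (b + 1) := by
  refine (List.sum_le_card_nsmul _ (b + 1) fun x hx => ?_).trans (by simp)
  obtain ⟨a, ha, rfl⟩ := List.mem_map.1 hx
  obtain ⟨i, hi, rfl⟩ := List.getElem_of_mem ha
  have h₁ := h i hi
  rw [List.getD_eq_getElem _ _ hi] at h₁
  have h₂ : Nat.size l[i] ≤ l[i] := Nat.size_le.2 Nat.lt_two_pow_self
  omega

theorem DecisionProblem.length_encode_le_size (P : DecisionProblem) (I : P.Instance) :
    (P.encode I).length ≤ P.size I := by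
  simp [DecisionProblem.size]

namespace CNFFormula

theorem length_lt_length_encode (φ : CNFFormula) {c : List (Fin φ.numVars × Bool)}
    (hc : c ∈ φ.clauses) : c.length < φ.encode.length := by
  have := (List.sublist_flatten_of_mem (List.mem_map_of_mem
    (f := fun c : List (Fin φ.numVars × Bool) => c.length :: c.map fun l => 2 * (l.1 : ℕ) + l.2.toNat)
    hc)).length_le
  simp only [List.length_cons, List.length_map] at this
  simp only [encode, List.length_cons, List.flatMap]
  omega

/-- The number of variables has to appear, since the size of the input only counts its bit length.
-/
theorem array_le (φ : CNFFormula) (i : ℕ) : φ.array i ≤ 2 * φ.numVars + φ.encode.length := by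
  have hmem : φ.array i = 0 ∨ φ.array i ∈ φ.encode := by
    rcases Nat.lt_or_ge i φ.encode.length with hi | hi
    · right
      rw [array, List.getD_eq_getElem _ _ hi]
      exact List.getElem_mem hi
    · exact Or.inl (List.getD_eq_default _ _ hi)
  rcases hmem with h | h
  · omega
  · rw [encode, List.mem_cons, List.mem_cons, List.mem_flatMap] at h
    rcases h with h | h | ⟨c, hc, h⟩
    · omega
    · have : φ.clauses.length ≤ (φ.clauses.flatMap fun c =>
          c.length :: c.map fun l => 2 * (l.1 : ℕ) + l.2.toNat).length := by
        rw [List.length_flatMap]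
        simp
      simp only [encode, List.length_cons]
      omega
    · rcases List.mem_cons.1 h with h | h
      · have := φ.length_lt_length_encode hc
        omega
      · obtain ⟨l, -, hl⟩ := List.mem_map.1 h
        have := l.1.2
        have := Bool.toNat_le l.2
        omega

end CNFFormula

/-- A polynomial factor in the number of variables need not be polynomial in the size of the
formula, so it is absorbed by a slightly larger base. -/
theorem exists_pow_mul_pow_le (k : ℕ) {β γ : ℝ} (hβ : 0 < β) (hβγ : β < γ) :
    ∃ D : ℝ, 0 ≤ D ∧ ∀ n : ℕ, (2 * n + 5 : ℝ) ^ k * β ^ n ≤ D * γ ^ n := by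
  have hγ : 0 < γ := hβ.trans hβγ
  set r := β / γ with hr
  have hr0 : 0 < r := div_pos hβ hγ
  have hr1 : r < 1 := (div_lt_one hγ).2 hβγ
  obtain ⟨D, hD⟩ := (tendsto_pow_const_mul_const_pow_of_abs_lt_one k
    (by rwa [abs_of_pos hr0] : |r| < 1)).bddAbove_range
  have hD' : ∀ n : ℕ, (n : ℝ) ^ k * r ^ n ≤ D := fun n => hD ⟨n, rfl⟩
  have hD0 : 0 ≤ D := le_trans (by positivity) (hD' 1)
  refine ⟨5 ^ k * D / r, by positivity, fun n => ?_⟩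
  have h₁ := hD' (n + 1)
  have h₂ : (2 * n + 5 : ℝ) ^ k ≤ 5 ^ k * ((n + 1 : ℕ) : ℝ) ^ k := by
    rw [← mul_pow]
    refine pow_le_pow_left₀ (by positivity) ?_ k
    push_cast
    have : (0 : ℝ) ≤ n := n.cast_nonneg
    linarith
  have h₃ : β ^ n = r ^ n * γ ^ n := by
    rw [← mul_pow, hr, div_mul_cancel₀ _ hγ.ne']
  calc (2 * n + 5 : ℝ) ^ k * β ^ n ≤ 5 ^ k * ((n + 1 : ℕ) : ℝ) ^ k * β ^ n := by gcongr
    _ = 5 ^ k * (((n + 1 : ℕ) : ℝ) ^ k * r ^ (n + 1)) / r * γ ^ n := by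
      rw [h₃, pow_succ r n]
      field_simp
    _ ≤ 5 ^ k * D / r * γ ^ n := by gcongr

namespace CycleTransversal

open RAM

/-- A fast algorithm for a problem to which formulas are reduced by `cellTerm` yields a fast
algorithm for satisfiability. -/
theorem dSAT_solvable {P : DecisionProblem} {f : P.Instance → ℝ} (hP : P.SolvableInOStar f)
    (inst : CNFFormula → P.Instance) (len : Term)
    (hlen : ∀ φ : CNFFormula, (P.encode (inst φ)).length =
      len.eval φ.array φ.positions fun _ => 0)
    (hcell : ∀ φ : CNFFormula, ∀ i < (P.encode (inst φ)).length, (P.encode (inst φ)).getD i 0 =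
      cellTerm.eval φ.array φ.positions fun _ => i)
    (hyes : ∀ φ, P.IsYes (inst φ) ↔ φ.Satisfiable) {b : ℝ} (hb : 1 < b) (hb4 : b < 4) (K : ℕ)
    (hf : ∀ φ, f (inst φ) ≤ b ^ (numPaths φ.numVars + K)) :
    ∃ δ > 0, ∀ d, (dSAT d).SolvableInOStar fun φ => (2 - δ) ^ φ.1.numVars := by
  obtain ⟨p, C, c, hp⟩ := hP
  obtain ⟨q, hq⟩ := exists_program_comp len cellTerm p
  obtain ⟨c₁, hc₁⟩ := exists_overhead_bound len cellTerm
  -- Two variables per path: `b ^ (n / 2) = β ^ n`. The gap between `β` and the midpoint `γ < 2`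
  -- pays for polynomial factors in `n`.
  set β := √b with hβdef
  have hβsq : β ^ 2 = b := Real.sq_sqrt (by linarith)
  have hβ1 : 1 < β := by
    rw [hβdef, Real.lt_sqrt (by norm_num)]
    linarith
  have hβ2 : β < 2 := by
    rw [hβdef, Real.sqrt_lt' (by norm_num)]
    linarith
  set γ := (β + 2) / 2 with hγ
  -- The output has at most `X ^ c₁` cells with entries at most `X ^ c₁`, hence size at most `X ^ (2
  -- * c₁ + 1)`; this enters the running time with exponent `c`.
  set E := c₁ + (2 * c₁ + 1) * c with hE
  obtain ⟨D, hD0, hD⟩ := exists_pow_mul_pow_le E (by linarith : 0 < β) (by rw [hγ]; linarith : β < γ)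
  refine ⟨2 - γ, by rw [hγ]; linarith, fun d => ⟨q, ⌈(1 + C * b ^ K * β ^ 6) * D⌉₊, E, ?_⟩⟩
  rintro ⟨φ, hφ⟩
  obtain ⟨s, t, hrun, ht, hacc⟩ := hp (inst φ)
  obtain ⟨s', hrun', hs'⟩ := hq φ.encode (P.encode (inst φ)) (hlen φ) (hcell φ) s t hrun
  refine ⟨s', _, hrun', ?_, by rw [hs', hacc, hyes]; rfl⟩
  set z := (dSAT d).size ⟨φ, hφ⟩ with hz
  have hlenz : φ.encode.length ≤ z := (dSAT d).length_encode_le_size ⟨φ, hφ⟩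
  have hz1 : 1 ≤ z := le_trans (by simp [CNFFormula.encode]) hlenz
  set X := 2 * φ.numVars + z + 4 with hX
  have hX2 : 2 ≤ X := by omega
  obtain ⟨hover, hL, hval⟩ := hc₁ X hX2 φ.encode
    (fun i => (φ.array_le i).trans (by omega)) fun i => (φ.positions_le i).trans (by omega)
  have hsize : P.size (inst φ) ≤ X ^ (2 * c₁ + 1) := by
    refine (List.sum_map_size_le _ (X ^ c₁) fun i hi => ?_).trans ?_
    · rw [hcell φ i hi]
      exact hval i (lt_of_lt_of_eq hi (hlen φ))
    · rw [hlen]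
      have h1 : 1 ≤ X ^ c₁ := Nat.one_le_pow _ _ (by omega)
      calc _ ≤ X ^ c₁ * (X ^ c₁ + 1) := Nat.mul_le_mul_right _ hL
        _ ≤ X ^ c₁ * (X ^ c₁ * X) := Nat.mul_le_mul_left _ (by nlinarith)
        _ = X ^ (2 * c₁ + 1) := by ring
  have hXr : (1 : ℝ) ≤ X := by exact_mod_cast (by omega : 1 ≤ X)
  have hpow : b ^ numPaths φ.numVars ≤ β ^ 6 * β ^ φ.numVars := by
    rw [← hβsq, ← pow_mul, ← pow_add]
    exact pow_le_pow_right₀ hβ1.le (by simp only [numPaths]; omega)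
  have hb0 : (0 : ℝ) ≤ b := by linarith
  have hβ0 : (0 : ℝ) ≤ β := by linarith
  have hβn : (1 : ℝ) ≤ β ^ φ.numVars := one_le_pow₀ hβ1.le
  have h₁ : (t : ℝ) ≤ C * b ^ K * β ^ 6 * (X ^ E * β ^ φ.numVars) := by
    calc (t : ℝ) ≤ C * f (inst φ) * (P.size (inst φ) : ℝ) ^ c := ht
      _ ≤ C * (b ^ K * (β ^ 6 * β ^ φ.numVars)) * ((X : ℝ) ^ (2 * c₁ + 1)) ^ c := by
        have h₂ : f (inst φ) ≤ b ^ K * (β ^ 6 * β ^ φ.numVars) := by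
          refine (hf φ).trans ?_
          rw [pow_add, mul_comm]
          gcongr
        have h₃ : (P.size (inst φ) : ℝ) ^ c ≤ ((X : ℝ) ^ (2 * c₁ + 1)) ^ c := by
          gcongr
          exact_mod_cast hsize
        calc _ ≤ C * (b ^ K * (β ^ 6 * β ^ φ.numVars)) * (P.size (inst φ) : ℝ) ^ c := by gcongr
          _ ≤ _ := by gcongr
      _ = C * b ^ K * β ^ 6 * ((X : ℝ) ^ ((2 * c₁ + 1) * c) * β ^ φ.numVars) := by
        rw [pow_mul]
        ring
      _ ≤ C * b ^ K * β ^ 6 * (X ^ E * β ^ φ.numVars) := by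
        gcongr
        omega
  have h₂ : (overhead len cellTerm φ.encode : ℝ) ≤ X ^ E * β ^ φ.numVars := by
    calc (overhead len cellTerm φ.encode : ℝ) ≤ (X : ℝ) ^ c₁ := by exact_mod_cast hover
      _ ≤ (X : ℝ) ^ E := pow_le_pow_right₀ hXr (by omega)
      _ ≤ X ^ E * β ^ φ.numVars := le_mul_of_one_le_right (by positivity) hβn
  have h₃ : (X : ℝ) ^ E * β ^ φ.numVars ≤ D * γ ^ φ.numVars * (z : ℝ) ^ E := by
    have h₄ : (X : ℝ) ≤ (2 * φ.numVars + 5) * z := by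
      have : X ≤ (2 * φ.numVars + 5) * z := by
        rw [hX]
        nlinarith
      exact_mod_cast this
    calc (X : ℝ) ^ E * β ^ φ.numVars ≤ ((2 * φ.numVars + 5) * z) ^ E * β ^ φ.numVars := by gcongr
      _ = (2 * φ.numVars + 5) ^ E * β ^ φ.numVars * (z : ℝ) ^ E := by
        rw [mul_pow]
        ring
      _ ≤ D * γ ^ φ.numVars * (z : ℝ) ^ E := by
        exact mul_le_mul_of_nonneg_right (hD _) (by positivity)
  have hγ0 : (0 : ℝ) ≤ γ := by rw [hγ]; linarith
  have hceil := Nat.le_ceil ((1 + C * b ^ K * β ^ 6) * D)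
  push_cast
  calc (overhead len cellTerm φ.encode : ℝ) + t
      ≤ (1 + C * b ^ K * β ^ 6) * (X ^ E * β ^ φ.numVars) := by linarith
    _ ≤ (1 + C * b ^ K * β ^ 6) * (D * γ ^ φ.numVars * (z : ℝ) ^ E) := by gcongr
    _ = (1 + C * b ^ K * β ^ 6) * D * γ ^ φ.numVars * (z : ℝ) ^ E := by ring
    _ ≤ _ := by
      rw [sub_sub_cancel]
      gcongr

/-- The graph with a single edge. -/
def edgeInstance : GraphWithBudget where
  n := 2
  G := ⊤
  k := 0

/-- On an instance of width `1` the assumed time bound is a multiple of `4 - ε`, which must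
therefore be positive. -/
theorem arrangementWidth_top (ℓ : Fin 2 ≃ Fin 2) :
    (⊤ : SimpleGraph (Fin 2)).arrangementWidth ℓ = 1 := by
  have h₀ : (⊤ : SimpleGraph (Fin 2)).arrangementCut ℓ 0 = {s(ℓ 0, ℓ 1)} := by
    ext e
    simp only [SimpleGraph.arrangementCut, Set.mem_ofPred_eq, Set.mem_singleton_iff]
    constructor
    · rintro ⟨-, j, k, hj, hk, rfl⟩
      obtain rfl : j = 0 := by omega
      obtain rfl : k = 1 := by omega
      rfl
    · rintro rfl
      exact ⟨by simp, 0, 1, le_rfl, by simp, rfl⟩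
  have h₁ : (⊤ : SimpleGraph (Fin 2)).arrangementCut ℓ 1 = ∅ := by
    ext e
    simp only [SimpleGraph.arrangementCut, Set.mem_ofPred_eq, Set.mem_empty_iff_false, iff_false]
    rintro ⟨-, j, k, hj, hk, -⟩
    omega
  rw [SimpleGraph.arrangementWidth, Fin.univ_succ]
  simp [h₀, h₁]

theorem cutwidth_top : (⊤ : SimpleGraph (Fin 2)).cutwidth = 1 := by
  simp [SimpleGraph.cutwidth, arrangementWidth_top]

/-- A problem cannot be solved in time `O*(f)` if `f` takes a value that is not positive. -/
theorem pos_of_solvable {P : DecisionProblem} {f : P.Instance → ℝ} (hP : P.SolvableInOStar f)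
    (I : P.Instance) : 0 < f I := by
  obtain ⟨p, C, c, hp⟩ := hP
  obtain ⟨s, t, hrun, ht, -⟩ := hp I
  by_contra! hneg
  have h₁ : (1 : ℝ) ≤ t := by exact_mod_cast hrun.one_le
  have h₂ : C * f I * (P.size I : ℝ) ^ c ≤ 0 :=
    mul_nonpos_of_nonpos_of_nonneg (mul_nonpos_of_nonneg_of_nonpos (by positivity) hneg)
      (by positivity)
  linarith

theorem arrangementWidth_reduction_le (φ : CNFFormula) :
    (reduction φ).G.arrangementWidth (Equiv.refl _) ≤ numPaths φ.numVars + 72902 :=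
  arrangementWidth_le _ (by simp [numPaths])

theorem pow_le_pow_of_le {x b : ℝ} {m n : ℕ} (hx : 0 < x) (hxb : x ≤ b) (hb : 1 ≤ b)
    (hmn : m ≤ n) : x ^ m ≤ b ^ n :=
  (pow_le_pow_left₀ hx.le hxb m).trans (pow_le_pow_right₀ hb hmn)

end CycleTransversal

open CycleTransversal

theorem mainTheorem5 (hSETH : SETH) (ε : ℝ) (hε : 0 < ε) :
    (¬ ConnectedOCT.SolvableInOStar fun I : GraphWithBudget => (4 - ε) ^ I.G.cutwidth) ∧
    (¬ ConnectedOCTArranged.SolvableInOStar fun I : ArrangedGraphWithBudget =>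
      (4 - ε) ^ I.G.arrangementWidth I.arrangement) := by
  -- The maximum keeps the base above `1` when `ε` is large, so powers are monotone in the exponent.
  have hb : 1 < max (4 - ε) 2 := lt_max_of_lt_right (by norm_num)
  have hb4 : max (4 - ε) 2 < 4 := max_lt (by linarith) (by norm_num)
  constructor
  · intro h
    have hpos : 0 < 4 - ε := by
      have := pos_of_solvable h edgeInstance
      simpa [edgeInstance, cutwidth_top] using this
    obtain ⟨δ, hδ, hsat⟩ := dSAT_solvable h reduction lengthTerm
      (fun φ => (encode_gridInstance _ (numSegments_pos φ)).1.trans (eval_lengthTerm φ _).symm)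
      (fun φ i hi => by
        have henc := encode_gridInstance (N := numPaths φ.numVars) (Good φ) (numSegments_pos φ)
        exact (henc.2 i (henc.1 ▸ hi)).trans (eval_cellTerm φ i).symm)
      hasConnectedOCT_reduction hb hb4 72902 fun φ =>
        pow_le_pow_of_le hpos (le_max_left _ _) hb.le
          ((ciInf_le (OrderBot.bddBelow _) (Equiv.refl _)).trans (arrangementWidth_reduction_le φ))
    obtain ⟨d, hd⟩ := hSETH δ hδ
    exact hd (hsat d)
  · intro h
    have hpos : 0 < 4 - ε := by
      have := pos_of_solvable h ⟨edgeInstance, Equiv.refl _⟩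
      simpa [edgeInstance, arrangementWidth_top] using this
    obtain ⟨δ, hδ, hsat⟩ := dSAT_solvable h
      (fun φ => arrangedGridInstance (numPaths φ.numVars) (numSegments φ) (Good φ))
      arrangedLengthTerm
      (fun φ => (encode_arrangedGridInstance _ (numSegments_pos φ)).1.trans
        (eval_arrangedLengthTerm φ _).symm)
      (fun φ i hi => by
        have henc := encode_arrangedGridInstance (N := numPaths φ.numVars) (Good φ)
          (numSegments_pos φ)
        exact (henc.2 i (henc.1 ▸ hi)).trans (eval_cellTerm φ i).symm)
      hasConnectedOCT_reduction hb hb4 72902 fun φ =>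
        pow_le_pow_of_le hpos (le_max_left _ _) hb.le (arrangementWidth_reduction_le φ)
    obtain ⟨d, hd⟩ := hSETH δ hδ
    exact hd (hsat d)
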